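/- A graph (finite, simple, undirected) is called irreducible if it is $K_4$-free, has no induced diamond ($K_4$ minus an edge), and has no siblings, that is, no two distinct vertices $u,v$ with $N(u)\subseteq N(v)$. The $3$-coloring problem is to decide whether a given graph has a proper $3$-coloring, and to compute one if it exists. Theorem. There are a single deterministic algorithm and an absolute constant $C$ such that, for every $n$ and every irreducible graph $G$ with $n$ vertices and diameter $3$, given $G$ by its adjacency matrix, the algorithm solves the $3$-coloring problem on $G$ in at most $$2^{C\cdot\min\{\delta\Delta,\ \frac{n}{\delta}\log_2\delta\}}$$ steps, where $\delta$ and $\Delta$ are the minimum and the maximum degree of $G$. Here an algorithm is a program of a unit-cost random access machine whose only arithmetic operations are addition and truncated subtraction of natural numbers (a model that is polynomially equivalent to Turing machines). -/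

import Mathlib

/-! ### Irreducible graphs -/

/-- Four vertices induce a diamond (`K₄` minus the edge `u₁u₂`), so that the rule "merge the two
non-adjacent vertices of an induced diamond" can be applied. -/
def DiamondRuleApplies {V : Type*} (G : SimpleGraph V) : Prop :=
  ∃ u₁ u₂ u₃ u₄ : V, u₁ ≠ u₂ ∧ ¬ G.Adj u₁ u₂ ∧
    G.Adj u₁ u₃ ∧ G.Adj u₁ u₄ ∧ G.Adj u₂ u₃ ∧ G.Adj u₂ u₄ ∧ G.Adj u₃ u₄

/-- There are siblings, i.e. distinct `u`, `v` with `N(u) ⊆ N(v)`, so that the rule "remove `u`"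
can be applied. (Such `u`, `v` are never adjacent, since `v ∉ N(v)`.) -/
def SiblingsRuleApplies {V : Type*} (G : SimpleGraph V) : Prop :=
  ∃ u v : V, u ≠ v ∧ G.neighborSet u ⊆ G.neighborSet v

/-- A graph is irreducible if it is `K₄`-free and neither reduction rule can be applied to it. -/
structure IsIrreducibleGraph {V : Type*} (G : SimpleGraph V) : Prop where
  cliqueFree : G.CliqueFree 4
  diamond : ¬ DiamondRuleApplies G
  siblings : ¬ SiblingsRuleApplies G

/-! ### A random access machine with a step count

Structured programs over natural number registers and arrays with indirect addressing. Every
elementary operation costs one step. The only arithmetic is addition and truncated subtraction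
(there is no unit-cost multiplication), so the machine is polynomially equivalent to a Turing
machine. -/

namespace RAM

/-- A memory state: the registers `var x` and the cells `arr a i` of the arrays `arr a`. -/
structure State where
  var : ℕ → ℕ
  arr : ℕ → ℕ → ℕ

/-- Expressions: constants, registers, array cells with a computed index, sum, and truncated
difference. -/
inductive Expr where
  | const (c : ℕ)
  | var (x : ℕ)
  | get (a : ℕ) (i : Expr)
  | add (e f : Expr)
  | sub (e f : Expr)

/-- The value of an expression. -/
def Expr.eval (s : State) : Expr → ℕ
  | .const c => c
  | .var x => s.var x
  | .get a i => s.arr a (i.eval s)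
  | .add e f => e.eval s + f.eval s
  | .sub e f => e.eval s - f.eval s

/-- The number of steps that the evaluation of an expression takes: one for each node. -/
def Expr.cost : Expr → ℕ
  | .const _ => 1
  | .var _ => 1
  | .get _ i => 1 + i.cost
  | .add e f => 1 + e.cost + f.cost
  | .sub e f => 1 + e.cost + f.cost

/-- Programs. The tests of `ite` and `loop` ask whether the value of an expression is nonzero;
`loop e p` is "while `e ≠ 0` do `p`". -/
inductive Program where
  | skip
  | assign (x : ℕ) (e : Expr)
  | store (a : ℕ) (i e : Expr)
  | seq (p q : Program)
  | ite (e : Expr) (p q : Program)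
  | loop (e : Expr) (p : Program)

/-- Write the value `v` into register `x`. -/
def State.setVar (s : State) (x v : ℕ) : State :=
  { s with var := Function.update s.var x v }

/-- Write the value `v` into cell `i` of array `a`. -/
def State.setArr (s : State) (a i v : ℕ) : State :=
  { s with arr := Function.update s.arr a (Function.update (s.arr a) i v) }

/-- `Runs p s t s'`: the program `p`, started in state `s`, halts after exactly `t` steps, in
state `s'`. -/
inductive Runs : Program → State → ℕ → State → Prop where
  | skip (s : State) : Runs .skip s 1 s
  | assign (s : State) (x : ℕ) (e : Expr) :
      Runs (.assign x e) s (1 + e.cost) (s.setVar x (e.eval s))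
  | store (s : State) (a : ℕ) (i e : Expr) :
      Runs (.store a i e) s (1 + i.cost + e.cost) (s.setArr a (i.eval s) (e.eval s))
  | seq {p q : Program} {s s₁ s₂ : State} {t₁ t₂ : ℕ} :
      Runs p s t₁ s₁ → Runs q s₁ t₂ s₂ → Runs (.seq p q) s (t₁ + t₂) s₂
  | iteTrue {e : Expr} {p q : Program} {s s' : State} {t : ℕ} :
      e.eval s ≠ 0 → Runs p s t s' → Runs (.ite e p q) s (1 + e.cost + t) s'
  | iteFalse {e : Expr} {p q : Program} {s s' : State} {t : ℕ} :
      e.eval s = 0 → Runs q s t s' → Runs (.ite e p q) s (1 + e.cost + t) s'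
  | loopTrue {e : Expr} {p : Program} {s s₁ s₂ : State} {t₁ t₂ : ℕ} :
      e.eval s ≠ 0 → Runs p s t₁ s₁ → Runs (.loop e p) s₁ t₂ s₂ →
      Runs (.loop e p) s (1 + e.cost + t₁ + t₂) s₂
  | loopFalse {e : Expr} {p : Program} {s : State} :
      e.eval s = 0 → Runs (.loop e p) s (1 + e.cost) s

/-- The machine is deterministic. -/
theorem Runs.unique {p : Program} {s s₁ s₂ : State} {t₁ t₂ : ℕ}
    (h₁ : Runs p s t₁ s₁) (h₂ : Runs p s t₂ s₂) : t₁ = t₂ ∧ s₁ = s₂ := by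
  induction h₁ generalizing t₂ s₂ with
  | skip => cases h₂; exact ⟨rfl, rfl⟩
  | assign => cases h₂; exact ⟨rfl, rfl⟩
  | store => cases h₂; exact ⟨rfl, rfl⟩
  | seq _ _ ih₁ ih₂ =>
    cases h₂ with
    | seq a b =>
      obtain ⟨rfl, rfl⟩ := ih₁ a
      obtain ⟨rfl, rfl⟩ := ih₂ b
      exact ⟨rfl, rfl⟩
  | iteTrue h _ ih =>
    cases h₂ with
    | iteTrue _ a => obtain ⟨rfl, rfl⟩ := ih a; exact ⟨rfl, rfl⟩
    | iteFalse h' _ => exact absurd h' h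
  | iteFalse h _ ih =>
    cases h₂ with
    | iteTrue h' _ => exact absurd h h'
    | iteFalse _ a => obtain ⟨rfl, rfl⟩ := ih a; exact ⟨rfl, rfl⟩
  | loopTrue h _ _ ih₁ ih₂ =>
    cases h₂ with
    | loopTrue _ a b =>
      obtain ⟨rfl, rfl⟩ := ih₁ a
      obtain ⟨rfl, rfl⟩ := ih₂ b
      exact ⟨rfl, rfl⟩
    | loopFalse h' => exact absurd h' h
  | loopFalse h =>
    cases h₂ with
    | loopTrue h' _ _ => exact absurd h h'
    | loopFalse _ => exact ⟨rfl, rfl⟩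

open Classical in
/-- The initial state on the input graph `G` with vertices `0, …, n - 1`: register `0` holds `n`,
array `0` holds the adjacency matrix row by row, everything else is `0`. -/
noncomputable def inputState {n : ℕ} (G : SimpleGraph (Fin n)) : State where
  var x := if x = 0 then n else 0
  arr a k := if a = 0 ∧ ∃ u v : Fin n, k = (u : ℕ) * n + (v : ℕ) ∧ G.Adj u v then 1 else 0

/-- The final state `s` answers the `3`-coloring problem for `G`: either register `0` holds `1` and
array `1` holds a proper `3`-coloring of `G`, or register `0` holds `0` and `G` has no proper
`3`-coloring. -/
def IsThreeColoringAnswer {n : ℕ} (G : SimpleGraph (Fin n)) (s : State) : Prop :=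
  (s.var 0 = 1 ∧ ∃ c : G.Coloring (Fin 3), ∀ v : Fin n, s.arr 1 (v : ℕ) = (c v : ℕ)) ∨
    (s.var 0 = 0 ∧ ¬ G.Colorable 3)

end RAM

/-! ### Reasoning about programs -/

namespace RAM

/-! Call a list of vertices dominating if every vertex lies in it or has a neighbor in it. Once the
list is colored, every other vertex sees a color, so at most two colors remain for it, and deciding
whether the partial coloring extends is a 2-SAT problem, solvable in polynomial time. Trying all
colorings of a list of length `K` thus costs `3 ^ K` times a polynomial, and it remains to find a
short list.

There are two sources of lists. Since the diameter is 3, the endpoints of the walks of length 2 from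
any vertex `u` dominate (`exists_two_step_of_diam_eq_three`), and there are at most `deg u * Δ` such
walks, that is `δΔ` for `u` of minimum degree. On the other hand, greedily choosing a vertex with
the most unmarked neighbors marks at least a fraction `δ / n` of the unmarked vertices each time, by
double counting. After about `(n / δ) * log δ` choices at most `n / δ` vertices are unmarked, and
each further choice marks at least one (`greedy_spec`, `exists_rounds`). The program computes the
greedy list and replaces it by a walk list whenever that is shorter, so it need not know `δ` or `Δ`.

The 2-SAT part is limited backtracking (`probe_spec`, `extend_spec`). Give an uncolored vertex a
color and propagate forced colors. If this ends without conflict, it may be kept for good: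
`exists_below_of_closed` shows that no solution is lost. So choices are never undone later.

Polynomial factors are absorbed in the exponent. Absence of siblings gives `2 ≤ δ`, so both terms of
the minimum are at least 1, and `n` is at most 2 to twice either term (`card_le_of_two_step`,
`le_rpow_two_mul_div_mul_logb`). -/

@[simp] theorem State.setVar_var (s : State) (x v y : ℕ) :
    (s.setVar x v).var y = if y = x then v else s.var y := by
  simp [State.setVar, Function.update_apply]

@[simp] theorem State.setVar_arr (s : State) (x v : ℕ) : (s.setVar x v).arr = s.arr := rfl

@[simp] theorem State.setArr_var (s : State) (a i v : ℕ) : (s.setArr a i v).var = s.var := rfl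

@[simp] theorem State.setArr_arr (s : State) (a i v b j : ℕ) :
    (s.setArr a i v).arr b j = if b = a ∧ j = i then v else s.arr b j := by
  by_cases h : b = a
  · subst h; simp [State.setArr, Function.update_apply]
  · simp [State.setArr, h]

/-- The registers that a program may write to. -/
def Program.writesVar : Program → ℕ → Bool
  | .skip, _ => false
  | .assign x _, y => y == x
  | .store _ _ _, _ => false
  | .seq p q, y => p.writesVar y || q.writesVar y
  | .ite _ p q, y => p.writesVar y || q.writesVar y
  | .loop _ p, y => p.writesVar y

/-- The arrays that a program may write to. -/
def Program.writesArr : Program → ℕ → Bool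
  | .skip, _ => false
  | .assign _ _, _ => false
  | .store a _ _, b => b == a
  | .seq p q, b => p.writesArr b || q.writesArr b
  | .ite _ p q, b => p.writesArr b || q.writesArr b
  | .loop _ p, b => p.writesArr b

/-- The states `s` and `s'` agree on all that `p` does not write to. -/
structure Frame (p : Program) (s s' : State) : Prop where
  var : ∀ x, p.writesVar x = false → s'.var x = s.var x
  arr : ∀ a, p.writesArr a = false → s'.arr a = s.arr a

/-- The write sets are computed from the syntax, so for a concrete program every claim that some
register or array is preserved reduces to `rfl`. -/
theorem Runs.frame {p : Program} {s s' : State} {t : ℕ} (h : Runs p s t s') : Frame p s s' := by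
  induction h with
  | skip => exact ⟨fun _ _ => rfl, fun _ _ => rfl⟩
  | assign s x e =>
    refine ⟨fun y hy => ?_, fun _ _ => rfl⟩
    simp only [Program.writesVar, beq_eq_false_iff_ne] at hy
    simp [hy]
  | store s a i e =>
    refine ⟨fun _ _ => rfl, fun b hb => ?_⟩
    simp only [Program.writesArr, beq_eq_false_iff_ne] at hb
    funext j
    simp [hb]
  | seq _ _ ih₁ ih₂ =>
    refine ⟨fun y hy => ?_, fun b hb => ?_⟩
    · simp only [Program.writesVar, Bool.or_eq_false_iff] at hy
      rw [ih₂.var y hy.2, ih₁.var y hy.1]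
    · simp only [Program.writesArr, Bool.or_eq_false_iff] at hb
      rw [ih₂.arr b hb.2, ih₁.arr b hb.1]
  | iteTrue _ _ ih =>
    refine ⟨fun y hy => ?_, fun b hb => ?_⟩
    · simp only [Program.writesVar, Bool.or_eq_false_iff] at hy
      exact ih.var y hy.1
    · simp only [Program.writesArr, Bool.or_eq_false_iff] at hb
      exact ih.arr b hb.1
  | iteFalse _ _ ih =>
    refine ⟨fun y hy => ?_, fun b hb => ?_⟩
    · simp only [Program.writesVar, Bool.or_eq_false_iff] at hy
      exact ih.var y hy.2
    · simp only [Program.writesArr, Bool.or_eq_false_iff] at hb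
      exact ih.arr b hb.2
  | loopTrue _ _ _ ih₁ ih₂ =>
    exact ⟨fun y hy => by rw [ih₂.var y hy, ih₁.var y hy],
      fun b hb => by rw [ih₂.arr b hb, ih₁.arr b hb]⟩
  | loopFalse => exact ⟨fun _ _ => rfl, fun _ _ => rfl⟩

/-- Programs without loops. -/
def Program.isStraight : Program → Bool
  | .skip => true
  | .assign _ _ => true
  | .store _ _ _ => true
  | .seq p q => p.isStraight && q.isStraight
  | .ite _ p q => p.isStraight && q.isStraight
  | .loop _ _ => false

/-- The final state of a program without loops. -/
def Program.exec : Program → State → State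
  | .skip, s => s
  | .assign x e, s => s.setVar x (e.eval s)
  | .store a i e, s => s.setArr a (i.eval s) (e.eval s)
  | .seq p q, s => q.exec (p.exec s)
  | .ite e p q, s => if e.eval s = 0 then q.exec s else p.exec s
  | .loop _ _, s => s

/-- An upper bound for the number of steps of a program without loops. -/
def Program.bound : Program → ℕ
  | .skip => 1
  | .assign _ e => 1 + e.cost
  | .store _ i e => 1 + i.cost + e.cost
  | .seq p q => p.bound + q.bound
  | .ite e p q => 1 + e.cost + (p.bound + q.bound)
  | .loop _ _ => 0

theorem Program.runs_exec (p : Program) (hp : p.isStraight = true) (s : State) :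
    ∃ t ≤ p.bound, Runs p s t (p.exec s) := by
  induction p generalizing s with
  | skip => exact ⟨1, le_rfl, .skip s⟩
  | assign x e => exact ⟨_, le_rfl, .assign s x e⟩
  | store a i e => exact ⟨_, le_rfl, .store s a i e⟩
  | seq p q ihp ihq =>
    simp only [isStraight, Bool.and_eq_true] at hp
    obtain ⟨t₁, ht₁, h₁⟩ := ihp hp.1 s
    obtain ⟨t₂, ht₂, h₂⟩ := ihq hp.2 (p.exec s)
    exact ⟨t₁ + t₂, add_le_add ht₁ ht₂, .seq h₁ h₂⟩
  | ite e p q ihp ihq =>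
    simp only [isStraight, Bool.and_eq_true] at hp
    by_cases he : e.eval s = 0
    · obtain ⟨t, ht, h⟩ := ihq hp.2 s
      refine ⟨1 + e.cost + t, by simp only [bound]; omega, ?_⟩
      simpa [exec, he] using Runs.iteFalse (p := p) he h
    · obtain ⟨t, ht, h⟩ := ihp hp.1 s
      refine ⟨1 + e.cost + t, by simp only [bound]; omega, ?_⟩
      simpa [exec, he] using Runs.iteTrue (q := q) he h
  | loop e p => simp [isStraight] at hp

/-- Started in `s`, the program `p` halts after at most `B ^ k` steps in a state that satisfies
`Q`. -/
def Does (B k : ℕ) (p : Program) (s : State) (Q : State → Prop) : Prop :=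
  ∃ t s', Runs p s t s' ∧ t ≤ B ^ k ∧ Q s'

namespace Does

variable {B i j k N : ℕ} {p q : Program} {s : State} {Q R : State → Prop}

theorem mono (h : Does B k p s Q) (hQ : ∀ s', Frame p s s' → Q s' → R s') : Does B k p s R := by
  obtain ⟨t, s', hr, ht, hq⟩ := h
  exact ⟨t, s', hr, ht, hQ s' hr.frame hq⟩

theorem exec (hB : 100 ≤ B) (hp : p.isStraight = true) (hb : p.bound ≤ 100) (hQ : Q (p.exec s)) :
    Does B 1 p s Q := by
  obtain ⟨t, ht, h⟩ := p.runs_exec hp s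
  exact ⟨t, _, h, by rw [pow_one]; omega, hQ⟩

/-- Costs are tracked only as exponents of one base `B`: two parts of smaller exponent cost at most
`2 * B ^ (k - 1) ≤ B ^ k`. With numeric exponents the side conditions are decidable. -/
theorem seq (hB : 100 ≤ B) (h₁ : Does B i p s R)
    (h₂ : ∀ s', Frame p s s' → R s' → Does B j q s' Q)
    (hi : i < k := by decide) (hj : j < k := by decide) : Does B k (p.seq q) s Q := by
  obtain ⟨t₁, s₁, hr₁, ht₁, hR⟩ := h₁
  obtain ⟨t₂, s₂, hr₂, ht₂, hQ⟩ := h₂ s₁ hr₁.frame hR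
  refine ⟨t₁ + t₂, s₂, .seq hr₁ hr₂, ?_, hQ⟩
  obtain ⟨k, rfl⟩ : ∃ l, k = l + 1 := ⟨k - 1, by omega⟩
  have h1 : B ^ i ≤ B ^ k := Nat.pow_le_pow_right (by omega) (by omega)
  have h2 : B ^ j ≤ B ^ k := Nat.pow_le_pow_right (by omega) (by omega)
  calc t₁ + t₂ ≤ B ^ k * 2 := by omega
    _ ≤ B ^ (k + 1) := by rw [pow_succ]; exact Nat.mul_le_mul_left _ (by omega)

theorem ite {e : Expr} (hB : 100 ≤ B) (he : e.cost < 99)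
    (h₁ : e.eval s ≠ 0 → Does B i p s Q) (h₂ : e.eval s = 0 → Does B j q s Q)
    (hi : i < k := by decide) (hj : j < k := by decide) : Does B k (.ite e p q) s Q := by
  obtain ⟨k, rfl⟩ : ∃ l, k = l + 1 := ⟨k - 1, by omega⟩
  have hpos : 1 ≤ B ^ k := Nat.one_le_pow _ _ (by omega)
  have h1 : B ^ i ≤ B ^ k := Nat.pow_le_pow_right (by omega) (by omega)
  have h2 : B ^ j ≤ B ^ k := Nat.pow_le_pow_right (by omega) (by omega)
  have h3 : B ^ k * 100 ≤ B ^ (k + 1) := by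
    rw [pow_succ]; exact Nat.mul_le_mul_left _ hB
  by_cases h : e.eval s = 0
  · obtain ⟨t, s', hr, ht, hQ⟩ := h₂ h
    exact ⟨_, s', .iteFalse h hr, by omega, hQ⟩
  · obtain ⟨t, s', hr, ht, hQ⟩ := h₁ h
    exact ⟨_, s', .iteTrue h hr, by omega, hQ⟩

end Does

/-- The program `if e ≠ 0 then p`. -/
def Program.when (e : Expr) (p : Program) : Program := .ite e p .skip

/-- The program `for x = 0, …, y - 1 do p`, where `y` is a register. -/
def Program.forLoop (x y : ℕ) (p : Program) : Program :=
  .seq (.assign x (.const 0))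
    (.loop (.sub (.var y) (.var x)) (.seq p (.assign x (.add (.var x) (.const 1)))))

/-- A loop of fewer than `B` rounds raises the exponent by one. The invariant must survive
overwriting the counter, since the loop resets and increments it. The body may use the frame of the
whole loop, so what the loop never writes need not be in the invariant. -/
theorem Does.forLoop {B k N x y : ℕ} {p : Program} {s : State} (hB : 100 ≤ B)
    (I : ℕ → State → Prop) (hN : N + 10 ≤ B) (hk : 1 ≤ k) (hy : s.var y = N)
    (hI : ∀ i s v, I i s → I i (s.setVar x v)) (h0 : I 0 s)
    (hb : ∀ i, i < N → ∀ s', s'.var x = i → Frame (.forLoop x y p) s s' → I i s' →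
      Does B k p s' (I (i + 1)))
    (hpx : p.writesVar x = false := by rfl) (hpy : p.writesVar y = false := by rfl)
    (hxy : (y == x) = false := by rfl) :
    Does B (k + 1) (.forLoop x y p) s (I N) := by
  have hyw : (Program.forLoop x y p).writesVar y = false := by
    simp [Program.forLoop, Program.writesVar, hpy, hxy]
  have key : ∀ d i s', i + d = N → s'.var x = i → Frame (.forLoop x y p) s s' → I i s' →
      ∃ t s'', Runs (.loop (.sub (.var y) (.var x))
        (.seq p (.assign x (.add (.var x) (.const 1))))) s' t s'' ∧
        -- The test costs 4 steps and the increment 4, hence 8 per round and 4 for the final failing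
        -- test.
        t ≤ d * (B ^ k + 8) + 4 ∧ I N s'' := by
    intro d
    induction d with
    | zero =>
      intro i s' hi hx hf hIi
      refine ⟨_, s', .loopFalse ?_, by simp [Expr.cost], by rwa [← hi]⟩
      simp only [Expr.eval, hx, hf.var y hyw, hy]
      omega
    | succ d ih =>
      intro i s' hi hx hf hIi
      obtain ⟨t₁, s₁, hr₁, ht₁, hI₁⟩ := hb i (by omega) s' hx hf hIi
      have hr₂ := Runs.seq hr₁ (.assign s₁ x (.add (.var x) (.const 1)))
      have hf₁ := hr₁.frame
      have hx₁ : s₁.var x = i := by rw [hf₁.var x hpx, hx]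
      have hf₂ : Frame (.forLoop x y p) s
          (s₁.setVar x ((Expr.add (.var x) (.const 1)).eval s₁)) := by
        have hf₂ := hr₂.frame
        refine ⟨fun z hz => ?_, fun a ha => ?_⟩
        · rw [← hf.var z hz]
          apply hf₂.var
          simp [Program.forLoop, Program.writesVar] at hz ⊢
          exact hz.2
        · rw [← hf.arr a ha]
          apply hf₂.arr
          simpa [Program.forLoop, Program.writesArr] using ha
      obtain ⟨t, s'', hr, ht, hIN⟩ := ih (i + 1) _ (by omega) (by simp [Expr.eval, hx₁]) hf₂
        (hI _ _ _ hI₁)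
      refine ⟨_, s'', .loopTrue ?_ hr₂ hr, ?_, hIN⟩
      · simp only [Expr.eval, hx, hf.var y hyw, hy]
        omega
      · simp only [Expr.cost]
        rw [Nat.add_mul, one_mul]
        omega
  have hr₀ := Runs.assign s x (.const 0)
  obtain ⟨t, s', hr, ht, hIN⟩ := key N 0 (s.setVar x 0) (by omega) (by simp)
    ⟨fun z hz => by
      apply hr₀.frame.var
      simp only [Program.forLoop, Program.writesVar, Bool.or_eq_false_iff] at hz ⊢
      exact hz.1, fun a _ => rfl⟩ (hI _ _ _ h0)
  refine ⟨_, s', .seq hr₀ hr, ?_, hIN⟩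
  have h1 : B ≤ B ^ k := Nat.le_self_pow (by omega) B
  calc 1 + Expr.cost (.const 0) + t ≤ N * (B ^ k + 8) + 6 := by simp only [Expr.cost]; omega
    _ ≤ (N + 10) * B ^ k := by nlinarith
    _ ≤ B ^ (k + 1) := by rw [pow_succ, mul_comm]; exact Nat.mul_le_mul_left _ hN

end RAM

/-! ### Partial three-colorings

A partial coloring is a function `f` to `ℕ` with values at most `3`, where the value `3` means that
the vertex is uncolored. -/

namespace PartialColoring

variable {V : Type*} {G : SimpleGraph V} {f g : V → ℕ}

/-- The coloring `χ` extends the partial coloring `f`. -/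
def Below (f : V → ℕ) (χ : G.Coloring (Fin 3)) : Prop := ∀ v, f v ≠ 3 → f v = χ v

/-- The neighbors `w` and `x` of `u` have different colors. -/
def Forced (G : SimpleGraph V) (f : V → ℕ) (u w x : V) : Prop :=
  G.Adj u w ∧ G.Adj u x ∧ f w < f x ∧ f x < 3

/-- One uncolored vertex with neighbors of two colors gets the third color. -/
def ForceStep (G : SimpleGraph V) (f g : V → ℕ) : Prop :=
  ∃ u w x, Forced G f u w x ∧ f u = 3 ∧
    (∀ v, v ≠ u → g v = f v) ∧ g u = 3 - f w - f x

/-- No uncolored vertex has neighbors of two colors. -/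
def Closed (G : SimpleGraph V) (f : V → ℕ) : Prop := ∀ u w x, Forced G f u w x → f u ≠ 3

/-- The partial coloring `g` is obtained from `f` by coloring forced vertices. -/
def Derives (G : SimpleGraph V) : (V → ℕ) → (V → ℕ) → Prop := Relation.ReflTransGen (ForceStep G)

/-- No two adjacent vertices have the same color. -/
def Proper (G : SimpleGraph V) (f : V → ℕ) : Prop := ∀ u w, G.Adj u w → f u < 3 → f u ≠ f w

theorem Derives.eq_of_ne (h : Derives G f g) {v : V} (hv : f v ≠ 3) : g v = f v := by
  induction h with
  | refl => rfl
  | tail _ hs ih =>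
    obtain ⟨u, w, x, -, hu, hg, -⟩ := hs
    rw [hg v (fun h => hv (by rw [← ih, h, hu])), ih]

theorem Derives.le (h : Derives G f g) (hf : ∀ v, f v ≤ 3) (v : V) : g v ≤ 3 := by
  induction h with
  | refl => exact hf v
  | tail _ hs ih =>
    obtain ⟨u, w, x, -, hu, hg, hgu⟩ := hs
    by_cases hv : v = u
    · rw [hv, hgu]; omega
    · rw [hg v hv]; exact ih

/-- The two neighbors carry their `χ`-colors, so `χ` has to use the third one; colors sum to 3,
hence the value `3 - f w - f x`. -/
theorem Derives.below (h : Derives G f g) {χ : G.Coloring (Fin 3)} (hf : Below f χ) :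
    Below g χ := by
  induction h with
  | refl => exact hf
  | tail _ hs ih =>
    obtain ⟨u, w, x, ⟨huw, hux, hwx, hx⟩, hu, hg, hgu⟩ := hs
    intro v hv
    by_cases h : v = u
    · subst h
      have h1 : χ v ≠ χ w := χ.valid huw
      have h2 : χ v ≠ χ x := χ.valid hux
      have h3 := ih w (by omega)
      have h4 := ih x (by omega)
      rw [Ne, Fin.ext_iff] at h1 h2
      omega
    · rw [hg v h] at hv ⊢
      exact ih v hv

theorem Derives.eq_of_closed (h : Derives G f g) (hf : Closed G f) : g = f := by
  induction h with
  | refl => rfl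
  | tail _ hs ih =>
    subst ih
    obtain ⟨u, w, x, hF, hu, -⟩ := hs
    exact absurd hu (hf u w x hF)

theorem Forced.of_derives {u w x : V} (h : Forced G f u w x) (hd : Derives G f g) :
    Forced G g u w x := by
  obtain ⟨h1, h2, h3, h4⟩ := h
  refine ⟨h1, h2, ?_⟩
  rw [hd.eq_of_ne (v := w) (by omega), hd.eq_of_ne (v := x) (by omega)]
  exact ⟨h3, h4⟩

theorem Derives.card_lt [Fintype V] (h : Derives G f g) {u : V} (hu : f u = 3) (hg : g u ≠ 3) :
    (Finset.univ.filter fun v => g v = 3).card < (Finset.univ.filter fun v => f v = 3).card := by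
  apply Finset.card_lt_card
  rw [Finset.ssubset_iff_of_subset]
  · exact ⟨u, by simpa using hu, by simpa using hg⟩
  · intro v
    simp only [Finset.mem_filter, Finset.mem_univ, true_and]
    intro hv
    by_contra hf
    exact hf (by rw [← h.eq_of_ne hf, hv])

/-- A closed proper partial coloring `g` that extends `f` can be extended to a coloring if `f` can,
provided that every vertex that is uncolored in `f` has a colored neighbor. -/
theorem exists_below_of_closed (hdom : ∀ v, f v = 3 → ∃ w, G.Adj v w ∧ f w ≠ 3)
    (hfg : ∀ v, f v ≠ 3 → g v = f v) (hg : ∀ v, g v ≤ 3) (hc : Closed G g) (hp : Proper G g)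
    {χ : G.Coloring (Fin 3)} (hχ : Below f χ) : ∃ χ' : G.Coloring (Fin 3), Below g χ' := by
  classical
  -- The new coloring is `g` where `g` is defined and `χ` elsewhere; this settles the mixed edges.
  -- The vertex `w` has a neighbor `x` colored by `f`. Closedness forbids two colors around `w`, so
  -- `g u = g x = χ x`, which differs from `χ w`.
  have key : ∀ u w, G.Adj u w → g u < 3 → g w = 3 → g u ≠ χ w := by
    intro u w huw hu hw h
    have hfw : f w = 3 := by
      by_contra hfw
      exact hfw (by rw [← hfg w hfw, hw])
    obtain ⟨x, hwx, hx⟩ := hdom w hfw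
    have hgx := hfg x hx
    have h1 := hg x
    have h2 : χ w ≠ χ x := χ.valid hwx
    rw [Ne, Fin.ext_iff, ← hχ x hx, ← hgx] at h2
    rcases Nat.lt_or_gt_of_ne (show g u ≠ g x by omega) with h3 | h3
    · exact hc w u x ⟨huw.symm, hwx, h3, by omega⟩ hw
    · exact hc w x u ⟨hwx, huw.symm, h3, by omega⟩ hw
  refine ⟨SimpleGraph.Coloring.mk
    (fun v => if h : g v < 3 then ⟨g v, h⟩ else χ v) ?_, ?_⟩
  · intro u w huw
    by_cases hu : g u < 3 <;> by_cases hw : g w < 3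
    · simpa [hu, hw] using hp u w huw hu
    · have := key u w huw hu (by have := hg w; omega)
      simp only [hu, hw, dite_true, dite_false, ne_eq, Fin.ext_iff]
      exact this
    · have := key w u huw.symm hw (by have := hg u; omega)
      simp only [hu, hw, dite_true, dite_false, ne_eq, Fin.ext_iff]
      exact this.symm
    · simpa [hu, hw] using χ.valid huw
  · intro v hv
    have h : g v < 3 := by have := hg v; omega
    change g v = ((if h : g v < 3 then ⟨g v, h⟩ else χ v : Fin 3) : ℕ)
    simp [h]

end PartialColoring

/-! ### Extending a partial coloring -/

namespace RAM

open PartialColoring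

variable {n B : ℕ} {G : SimpleGraph (Fin n)} {s s' : State}

/-- The first `n` entries of the array `a`. -/
def State.read (s : State) (a n : ℕ) : Fin n → ℕ := fun v => s.arr a v

@[simp] theorem State.read_setVar (s : State) (x v a n : ℕ) :
    (s.setVar x v).read a n = s.read a n := rfl

/-- Register `0` holds `n`, array `0` holds the adjacency matrix, and array `4` tells where its rows
begin. -/
structure Ready (G : SimpleGraph (Fin n)) (s : State) : Prop where
  size : s.var 0 = n
  adj : ∀ u v : Fin n, s.arr 0 (s.arr 4 u + v) ≠ 0 ↔ G.Adj u v

theorem Ready.frame {p : Program} (h : Ready G s) (hf : Frame p s s')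
    (h0 : p.writesVar 0 = false := by rfl) (ha : p.writesArr 0 = false := by rfl)
    (h4 : p.writesArr 4 = false := by rfl) : Ready G s' := by
  refine ⟨by rw [hf.var 0 h0, h.size], fun u v => ?_⟩
  rw [hf.arr 0 ha, hf.arr 4 h4]
  exact h.adj u v

/-- Are the vertices in the registers `x` and `y` adjacent? -/
def adjExpr (x y : ℕ) : Expr := .get 0 (.add (.get 4 (.var x)) (.var y))

theorem Ready.eval_adjExpr (h : Ready G s) {x y : ℕ} {u v : Fin n} (hx : s.var x = u)
    (hy : s.var y = v) : (adjExpr x y).eval s = 0 ↔ ¬ G.Adj u v := by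
  simp [adjExpr, Expr.eval, hx, hy, ← h.adj u v]

/-- Copy the first entries of the array `a` to the array `b`, as many as the register `y` says. -/
def copyArr (a b y : ℕ) : Program := .forLoop 1 y (.store b (.var 1) (.get a (.var 1)))

theorem copyArr_spec (hB : 100 ≤ B) {a b y N : ℕ} (hN : N + 10 ≤ B) (hy : s.var y = N)
    (hab : a ≠ b) (hy1 : y ≠ 1) :
    Does B 2 (copyArr a b y) s fun s' => ∀ i < N, s'.arr b i = s.arr a i := by
  refine Does.forLoop hB (fun i s' => ∀ j < i, s'.arr b j = s.arr a j) hN le_rfl hy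
    (fun _ _ _ h => h) (by simp) ?_ rfl rfl (by simpa using hy1)
  intro i hi s₁ hx hf hI
  refine Does.exec hB rfl (by simp [Program.bound, Expr.cost]) ?_
  intro j hj
  have ha : s₁.arr a = s.arr a :=
    hf.arr a (by simpa [Program.forLoop, Program.writesArr] using hab)
  by_cases h : j = i
  · simp [Program.exec, Expr.eval, hx, h, ha]
  · simp [Program.exec, Expr.eval, hx, h, hI j (by omega)]

/-- Color the vertex in register `1` in the array `7` if it is uncolored and the vertices in the
registers `3` and `2` force its color. -/
def forceStep : Program :=
  .when (adjExpr 1 3) (.when (adjExpr 1 2) (.ite (.sub (.const 3) (.get 7 (.var 1))) .skip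
    (.when (.sub (.get 7 (.var 2)) (.get 7 (.var 3)))
      (.when (.sub (.const 3) (.get 7 (.var 2)))
        (.store 7 (.var 1)
          (.sub (.sub (.const 3) (.get 7 (.var 3))) (.get 7 (.var 2))))))))

theorem forceStep_spec (hB : 100 ≤ B) (hr : Ready G s) (hle : ∀ v, s.read 7 n v ≤ 3)
    {u w x : Fin n} (hu : s.var 1 = u) (hw : s.var 3 = w) (hx : s.var 2 = x) :
    Does B 1 forceStep s fun s' => Derives G (s.read 7 n) (s'.read 7 n) ∧
      (Forced G (s.read 7 n) u w x → s'.read 7 n u ≠ 3) := by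
  refine Does.exec hB rfl (by decide) ?_
  classical
  have h1 := hr.eval_adjExpr hu hw
  have h2 := hr.eval_adjExpr hu hx
  have h3 := hle u
  by_cases hF : Forced G (s.read 7 n) u w x ∧ s.read 7 n u = 3
  · obtain ⟨⟨a, b, c, d⟩, e⟩ := hF
    have he : forceStep.exec s = s.setArr 7 u (3 - s.arr 7 w - s.arr 7 x) := by
      simp only [State.read] at c d e
      simp only [forceStep, Program.when, Program.exec, h1, h2, a, b, not_true_eq_false, if_false]
      simp only [Expr.eval, hu, hw, hx, e]
      rw [if_pos (by simp), if_neg (by omega), if_neg (by omega)]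
    have hgu : (forceStep.exec s).read 7 n u = 3 - s.read 7 n w - s.read 7 n x := by
      simp [he, State.read]
    refine ⟨.single ⟨u, w, x, ⟨a, b, c, d⟩, e, fun v hv => ?_, hgu⟩, fun _ => by omega⟩
    have : (v : ℕ) ≠ u := fun h => hv (Fin.ext h)
    simp [he, State.read, this]
  · have he : forceStep.exec s = s := by
      simp only [forceStep, Program.when, Program.exec, h1, h2]
      simp only [Expr.eval, hu, hw, hx]
      by_cases a : G.Adj u w
      · by_cases b : G.Adj u x
        · simp only [a, b, not_true_eq_false, if_false]
          split_ifs with c d e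
          · rfl
          · rfl
          · refine absurd ⟨⟨a, b, ?_, ?_⟩, ?_⟩ hF <;> simp only [State.read] at * <;> omega
          · rfl
        · simp [a, b]
      · simp [a]
    rw [he]
    exact ⟨.refl, fun h h3 => hF ⟨h, h3⟩⟩

/-- One round of forcing over all triples of vertices. -/
def forceRound : Program := .forLoop 1 0 (.forLoop 3 0 (.forLoop 2 0 forceStep))

/-- Only triples forced at the start of the round are promised to be treated. They stay forced while
other vertices are colored, so the order of the loops does not matter. -/
theorem forceRound_spec (hB : 100 ≤ B) (hn : n + 10 ≤ B) (hr : Ready G s)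
    (hle : ∀ v, s.read 7 n v ≤ 3) :
    Does B 4 forceRound s fun s' => Derives G (s.read 7 n) (s'.read 7 n) ∧
      ∀ u w x, Forced G (s.read 7 n) u w x → s'.read 7 n u ≠ 3 := by
  refine Does.mono (Q := fun s' => Derives G (s.read 7 n) (s'.read 7 n) ∧
      ∀ u : Fin n, (u : ℕ) < n → ∀ w x, Forced G (s.read 7 n) u w x → s'.read 7 n u ≠ 3) ?_
    fun s' _ h => ⟨h.1, fun u => h.2 u u.2⟩
  refine Does.forLoop hB (fun i s' => Derives G (s.read 7 n) (s'.read 7 n) ∧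
      ∀ u : Fin n, (u : ℕ) < i → ∀ w x, Forced G (s.read 7 n) u w x → s'.read 7 n u ≠ 3) hn
    (by decide) hr.size (fun _ _ _ h => h) ⟨.refl, by simp⟩ ?_
  intro i hi s₁ hu hf₁ ⟨hd₁, hI₁⟩
  have hr₁ := hr.frame hf₁
  refine Does.mono (Q := fun s' => Derives G (s₁.read 7 n) (s'.read 7 n) ∧
      ∀ w : Fin n, (w : ℕ) < n → ∀ x, Forced G (s₁.read 7 n) ⟨i, hi⟩ w x →
        s'.read 7 n ⟨i, hi⟩ ≠ 3) ?_ ?_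
  · refine Does.forLoop hB (fun j s' => Derives G (s₁.read 7 n) (s'.read 7 n) ∧
      ∀ w : Fin n, (w : ℕ) < j → ∀ x, Forced G (s₁.read 7 n) ⟨i, hi⟩ w x →
        s'.read 7 n ⟨i, hi⟩ ≠ 3) hn (by decide) hr₁.size (fun _ _ _ h => h) ⟨.refl, by simp⟩ ?_
    intro j hj s₂ hw hf₂ ⟨hd₂, hI₂⟩
    have hr₂ := hr₁.frame hf₂
    refine Does.mono (Q := fun s' => Derives G (s₂.read 7 n) (s'.read 7 n) ∧
      ∀ x : Fin n, (x : ℕ) < n → Forced G (s₂.read 7 n) ⟨i, hi⟩ ⟨j, hj⟩ x →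
        s'.read 7 n ⟨i, hi⟩ ≠ 3) ?_ ?_
    · refine Does.forLoop hB (fun k s' => Derives G (s₂.read 7 n) (s'.read 7 n) ∧
        ∀ x : Fin n, (x : ℕ) < k → Forced G (s₂.read 7 n) ⟨i, hi⟩ ⟨j, hj⟩ x →
          s'.read 7 n ⟨i, hi⟩ ≠ 3) hn (by decide) hr₂.size (fun _ _ _ h => h) ⟨.refl, by simp⟩ ?_
      intro k hk s₃ hx hf₃ ⟨hd₃, hI₃⟩
      refine (forceStep_spec hB (hr₂.frame hf₃) (Derives.le ((hd₁.trans hd₂).trans hd₃) hle)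
        (u := ⟨i, hi⟩) (w := ⟨j, hj⟩) (x := ⟨k, hk⟩) ?_ ?_ hx).mono ?_
      · rw [hf₃.var 1 rfl, hf₂.var 1 rfl, hu]
      · rw [hf₃.var 3 rfl, hw]
      · rintro s₄ - ⟨hd₄, hF⟩
        refine ⟨hd₃.trans hd₄, fun x hxk hFx => ?_⟩
        rcases Nat.lt_succ_iff_lt_or_eq.1 hxk with h | h
        · have := hI₃ x h hFx
          rwa [hd₄.eq_of_ne this]
        · obtain rfl : x = ⟨k, hk⟩ := Fin.ext h
          exact hF (hFx.of_derives hd₃)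
    · rintro s₄ - ⟨hd₄, hF⟩
      refine ⟨hd₂.trans hd₄, fun w hwj x hFx => ?_⟩
      rcases Nat.lt_succ_iff_lt_or_eq.1 hwj with h | h
      · have := hI₂ w h x hFx
        rwa [hd₄.eq_of_ne this]
      · obtain rfl : w = ⟨j, hj⟩ := Fin.ext h
        exact hF x x.2 (hFx.of_derives hd₂)
  · rintro s₄ - ⟨hd₄, hF⟩
    refine ⟨hd₁.trans hd₄, fun u hui w x hFx => ?_⟩
    rcases Nat.lt_succ_iff_lt_or_eq.1 hui with h | h
    · have := hI₁ u h w x hFx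
      rwa [hd₄.eq_of_ne this]
    · obtain rfl : u = ⟨i, hi⟩ := Fin.ext h
      exact hF w w.2 x (hFx.of_derives hd₁)

/-- Color forced vertices in the array `7` as long as there are any. -/
def propagate : Program := .forLoop 19 0 forceRound

/-- A round that starts from a coloring that is not closed colors at least one vertex, so `n` rounds
suffice. -/
theorem propagate_spec (hB : 100 ≤ B) (hn : n + 10 ≤ B) (hr : Ready G s)
    (hle : ∀ v, s.read 7 n v ≤ 3) :
    Does B 5 propagate s fun s' => Derives G (s.read 7 n) (s'.read 7 n) ∧
      Closed G (s'.read 7 n) := by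
  refine Does.mono (Q := fun s' => Derives G (s.read 7 n) (s'.read 7 n) ∧
    (Closed G (s'.read 7 n) ∨
      (Finset.univ.filter fun v => s'.read 7 n v = 3).card + n ≤ n)) ?_ ?_
  · refine Does.forLoop hB (fun i s' => Derives G (s.read 7 n) (s'.read 7 n) ∧
      (Closed G (s'.read 7 n) ∨
        (Finset.univ.filter fun v => s'.read 7 n v = 3).card + i ≤ n)) hn
      (by decide) hr.size (fun _ _ _ h => h) ⟨.refl, .inr ?_⟩ ?_
    · simpa using Finset.card_filter_le (Finset.univ : Finset (Fin n)) fun v => s.read 7 n v = 3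
    · rintro i hi s₁ - hf₁ ⟨hd₁, hI⟩
      refine (forceRound_spec hB hn (hr.frame hf₁) (hd₁.le hle)).mono ?_
      rintro s₂ - ⟨hd₂, hF⟩
      refine ⟨hd₁.trans hd₂, ?_⟩
      by_cases hc : Closed G (s₁.read 7 n)
      · rw [hd₂.eq_of_closed hc]
        exact .inl hc
      · have hc' := hc
        simp only [Closed, not_forall, not_not] at hc'
        obtain ⟨u, w, x, h, hu⟩ := hc'
        have := hd₂.card_lt hu (hF u w x h)
        rcases hI with hI | hI
        · exact absurd hI hc
        · right; omega
  · rintro s₁ - ⟨hd, hc | hc⟩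
    · exact ⟨hd, hc⟩
    · refine ⟨hd, fun u w x _ hu => ?_⟩
      have : u ∈ Finset.univ.filter fun v => s₁.read 7 n v = 3 := by simpa using hu
      have := Finset.card_pos.2 ⟨u, this⟩
      omega

/-- Set register `20` to `0` or `1` according to whether the partial coloring in the array `a` is
proper. -/
def check (a : ℕ) : Program :=
  .seq (.assign 20 (.const 0)) (.forLoop 1 0 (.forLoop 3 0 (.when (adjExpr 1 3)
    (.when (.sub (.const 3) (.get a (.var 1)))
      (.ite (.add (.sub (.get a (.var 1)) (.get a (.var 3)))
        (.sub (.get a (.var 3)) (.get a (.var 1)))) .skip (.assign 20 (.const 1)))))))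

theorem check_spec (hB : 100 ≤ B) (hn : n + 10 ≤ B) (hr : Ready G s) (a : ℕ) :
    Does B 4 (check a) s fun s' => s'.var 20 = 0 ↔ Proper G (s.read a n) := by
  refine Does.seq (i := 1) (j := 3) hB (R := fun s' => s'.var 20 = 0)
    (.exec hB rfl (by decide) rfl) ?_
  intro s₀ hf₀ h₀
  have hr₀ := hr.frame hf₀
  refine Does.mono (Q := fun s' => s'.var 20 = 0 ↔ ∀ u : Fin n, (u : ℕ) < n → ∀ w,
    G.Adj u w → s.read a n u < 3 → s.read a n u ≠ s.read a n w) ?_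
    fun s' _ h => h.trans ⟨fun h u => h u u.2, fun h u _ => h u⟩
  refine Does.forLoop hB (fun i s' => s'.var 20 = 0 ↔ ∀ u : Fin n, (u : ℕ) < i → ∀ w,
    G.Adj u w → s.read a n u < 3 → s.read a n u ≠ s.read a n w) hn (by decide) hr₀.size
    (fun _ _ _ h => by simpa using h) (by simpa using h₀) ?_
  intro i hi s₁ hu hf₁ hI₁
  have hr₁ := hr₀.frame hf₁
  refine Does.mono (Q := fun s' => s'.var 20 = 0 ↔ s₁.var 20 = 0 ∧ ∀ w : Fin n, (w : ℕ) < n →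
    G.Adj ⟨i, hi⟩ w → s.read a n ⟨i, hi⟩ < 3 → s.read a n ⟨i, hi⟩ ≠ s.read a n w) ?_ ?_
  · refine Does.forLoop hB (fun j s' => s'.var 20 = 0 ↔ s₁.var 20 = 0 ∧ ∀ w : Fin n,
      (w : ℕ) < j → G.Adj ⟨i, hi⟩ w → s.read a n ⟨i, hi⟩ < 3 →
        s.read a n ⟨i, hi⟩ ≠ s.read a n w) hn (by decide) hr₁.size
      (fun _ _ _ h => by simpa using h) (by simp) ?_
    intro j hj s₂ hw hf₂ hI₂
    have hr₂ := hr₁.frame hf₂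
    have hu₂ : s₂.var 1 = i := by rw [hf₂.var 1 rfl, hu]
    have hadj := hr₂.eval_adjExpr (u := ⟨i, hi⟩) (v := ⟨j, hj⟩) hu₂ hw
    have ha : s₂.arr a = s.arr a := by rw [hf₂.arr a rfl, hf₁.arr a rfl, hf₀.arr a rfl]
    have hsplit : (∀ w : Fin n, (w : ℕ) < j + 1 → G.Adj ⟨i, hi⟩ w → s.read a n ⟨i, hi⟩ < 3 →
        s.read a n ⟨i, hi⟩ ≠ s.read a n w) ↔ (∀ w : Fin n, (w : ℕ) < j → G.Adj ⟨i, hi⟩ w →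
        s.read a n ⟨i, hi⟩ < 3 → s.read a n ⟨i, hi⟩ ≠ s.read a n w) ∧ (G.Adj ⟨i, hi⟩ ⟨j, hj⟩ →
        s.arr a i < 3 → s.arr a i ≠ s.arr a j) := by
      refine ⟨fun h => ⟨fun w hw => h w (by omega), h ⟨j, hj⟩ (by simp)⟩, fun h w hw => ?_⟩
      rcases Nat.lt_succ_iff_lt_or_eq.1 hw with h' | h'
      · exact h.1 w h'
      · obtain rfl : w = ⟨j, hj⟩ := Fin.ext h'
        exact h.2
    refine Does.exec hB rfl (by simp [Program.when, adjExpr, Program.bound, Expr.cost]) ?_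
    classical
    rw [hsplit, ← and_assoc, ← hI₂]
    simp only [Program.when, Program.exec, hadj]
    simp only [Expr.eval, hu₂, hw, ha]
    by_cases h1 : G.Adj ⟨i, hi⟩ ⟨j, hj⟩
    · simp only [h1, not_true_eq_false, if_false, true_imp_iff]
      by_cases h2 : s.arr a i < 3
      · rw [if_neg (by omega)]
        -- The tested value is the sum of both truncated differences, which vanishes exactly when
        -- the colors agree.
        by_cases h3 : s.arr a i = s.arr a j
        · rw [if_pos (by omega)]
          simp [h3]
          omega
        · rw [if_neg (by omega)]
          simp [h3]
      · rw [if_pos (by omega)]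
        simp [h2]
    · simp [h1]
  · rintro s₄ - h
    rw [h, hI₁]
    refine ⟨fun h u hu => ?_, fun h => ⟨fun u hu => h u (by omega),
      fun w _ => h ⟨i, hi⟩ (by simp) w⟩⟩
    rcases Nat.lt_succ_iff_lt_or_eq.1 hu with h' | h'
    · exact h.1 u h'
    · obtain rfl : u = ⟨i, hi⟩ := Fin.ext h'
      exact fun w => h.2 w w.2

end RAM

/-! ### Extending a partial coloring by limited backtracking -/

namespace PartialColoring

variable {V : Type*} {G : SimpleGraph V} {f g h : V → ℕ}

/-- The partial coloring `g` extends `f`, and it can be extended to a coloring if `f` can. -/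
structure Improves (G : SimpleGraph V) (f g : V → ℕ) : Prop where
  eq_of_ne : ∀ v, f v ≠ 3 → g v = f v
  le : ∀ v, g v ≤ 3
  exists_below : (∃ χ : G.Coloring (Fin 3), Below f χ) → ∃ χ : G.Coloring (Fin 3), Below g χ

theorem Improves.refl (hf : ∀ v, f v ≤ 3) : Improves G f f := ⟨fun _ _ => rfl, hf, id⟩

theorem Improves.trans (h₁ : Improves G f g) (h₂ : Improves G g h) : Improves G f h := by
  refine ⟨fun v hv => ?_, h₂.le, fun hχ => h₂.exists_below (h₁.exists_below hχ)⟩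
  have := h₁.eq_of_ne v hv
  rw [h₂.eq_of_ne v (by rwa [this]), this]

/-- Every uncolored vertex has a colored neighbor. -/
def Dominated (G : SimpleGraph V) (f : V → ℕ) : Prop := ∀ v, f v = 3 → ∃ w, G.Adj v w ∧ f w ≠ 3

theorem Improves.dominated (h : Improves G f g) (hf : Dominated G f) : Dominated G g := by
  intro v hv
  have hv' : f v = 3 := by
    by_contra h'
    exact h' (by rw [← h.eq_of_ne v h', hv])
  obtain ⟨w, hvw, hw⟩ := hf v hv'
  exact ⟨w, hvw, by rwa [h.eq_of_ne w hw]⟩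

end PartialColoring

namespace RAM

open PartialColoring

variable {n B : ℕ} {G : SimpleGraph (Fin n)} {s s' : State}

/-- If the vertex in register `17` is uncolored in the array `6`, try to give it the color in
register `18`. -/
def probe : Program :=
  .ite (.sub (.const 3) (.get 6 (.var 17))) .skip
    (.seq (copyArr 6 7 0) (.seq (.store 7 (.var 17) (.var 18)) (.seq propagate
      (.seq (check 7) (.ite (.var 20) .skip (copyArr 7 6 0))))))

/-- Either the vertex ends up colored without losing solutions, or nothing changes and the tried
color is excluded for every coloring that extends the current one. -/
theorem probe_spec (hB : 100 ≤ B) (hn : n + 10 ≤ B) (hr : Ready G s)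
    (hle : ∀ v, s.read 6 n v ≤ 3) (hdom : Dominated G (s.read 6 n)) {v : Fin n}
    (hv : s.var 17 = v) (hc : s.var 18 < 3) :
    Does B 10 probe s fun s' => Improves G (s.read 6 n) (s'.read 6 n) ∧
      (s'.read 6 n v ≠ 3 ∨ s'.read 6 n = s.read 6 n ∧
        ∀ χ : G.Coloring (Fin 3), Below (s.read 6 n) χ → (χ v : ℕ) ≠ s.var 18) := by
  have hlev : s.arr 6 v ≤ 3 := hle v
  refine Does.ite (i := 1) (j := 9) hB (by decide) (fun he => ?_) (fun he => ?_)
  · refine .exec hB rfl (by decide) ⟨.refl hle, .inl ?_⟩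
    simp only [Expr.eval, hv] at he
    change s.arr 6 v ≠ 3
    omega
  simp only [Expr.eval, hv] at he
  have hv3 : s.read 6 n v = 3 := by
    change s.arr 6 v = 3
    omega
  refine Does.seq (i := 2) (j := 8) hB (copyArr_spec hB hn hr.size (by decide) (by decide)) ?_
  intro s₁ hf₁ h₁
  have hr₁ := hr.frame hf₁
  refine Does.seq (i := 1) (j := 7) hB (R := fun s' => s'.arr 6 = s.arr 6 ∧
    ∀ w : Fin n, s'.read 7 n w = if w = v then s.var 18 else s.read 6 n w)
    (.exec hB rfl (by decide) ?_) ?_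
  · refine ⟨?_, fun w => ?_⟩
    · funext j
      simp [Program.exec, hf₁.arr 6 rfl]
    · simp only [Program.exec, Expr.eval, State.read, State.setArr_arr, hf₁.var 17 rfl,
        hf₁.var 18 rfl, hv, h₁ w w.2, Fin.ext_iff, true_and]
  rintro s₂ hf₂ ⟨h6, h7⟩
  have hr₂ := hr₁.frame hf₂
  have hle₂ : ∀ w, s₂.read 7 n w ≤ 3 := by
    intro w
    rw [h7 w]
    split_ifs
    · omega
    · exact hle w
  refine Does.seq (i := 5) (j := 6) hB (propagate_spec hB hn hr₂ hle₂) ?_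
  rintro s₃ hf₃ ⟨hd, hcl⟩
  have hr₃ := hr₂.frame hf₃
  refine Does.seq (i := 4) (j := 5) hB (check_spec hB hn hr₃ 7) ?_
  intro s₄ hf₄ hp
  have hr₄ := hr₃.frame hf₄
  have h6₄ : s₄.arr 6 = s.arr 6 := by rw [hf₄.arr 6 rfl, hf₃.arr 6 rfl, h6]
  refine Does.ite (i := 1) (j := 2) hB (by decide) (fun he => ?_) (fun he => ?_)
  · have hread : s₄.read 6 n = s.read 6 n := by
      funext w
      simp [State.read, h6₄]
    refine .exec hB rfl (by decide) ?_
    simp only [Program.exec, hread]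
    refine ⟨.refl hle, .inr ⟨trivial, fun χ hχ hχv => ?_⟩⟩
    -- If `χ` gave `v` the tried color, propagation would stay below `χ` and hence be proper,
    -- contrary to the failed check.
    have hb : Below (s₂.read 7 n) χ := by
      intro w hw
      rw [h7 w] at hw ⊢
      split_ifs at hw ⊢ with h
      · rw [h, hχv]
      · exact hχ w hw
    have hb' := hd.below hb
    refine he (hp.2 fun u w huw hu h => ?_)
    have h1 := hb' u (by omega)
    have h2 := hb' w (by omega)
    exact χ.valid huw (Fin.ext (by omega))
  · refine (copyArr_spec hB hn hr₄.size (by decide) (by decide)).mono fun s₅ _ h₅ => ?_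
    have h57 : s₅.read 6 n = s₃.read 7 n := by
      funext w
      simp only [State.read]
      rw [h₅ w w.2, hf₄.arr 7 rfl]
    have hext : ∀ w, s.read 6 n w ≠ 3 → s₃.read 7 n w = s.read 6 n w := by
      intro w hw
      have hwv : w ≠ v := fun h => hw (by rw [h, hv3])
      have := h7 w
      rw [if_neg hwv] at this
      rw [hd.eq_of_ne (by rwa [this]), this]
    rw [h57]
    refine ⟨⟨hext, hd.le hle₂, fun ⟨χ, hχ⟩ =>
      exists_below_of_closed hdom hext (hd.le hle₂) hcl (hp.1 he) hχ⟩, .inl ?_⟩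
    have := h7 v
    rw [if_pos rfl] at this
    rw [hd.eq_of_ne (by omega), this]
    omega

/-- Extend the partial coloring in the array `6`, and set register `20` to `0` or `1` according to
whether this has led to a coloring. Register `11` must hold `3`. -/
def extend : Program :=
  .seq (.forLoop 17 0 (.forLoop 18 11 probe)) (.seq (check 6)
    (.forLoop 1 0 (.ite (.sub (.const 3) (.get 6 (.var 1))) .skip (.assign 20 (.const 1)))))

/-- If an extension exists, one of the three probes at each vertex must succeed, because all three
failing would exclude every color. So all vertices get colored, and the final test for a proper
total coloring is decisive. -/
theorem extend_spec (hB : 100 ≤ B) (hn : n + 10 ≤ B) (hr : Ready G s) (h11 : s.var 11 = 3)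
    (hle : ∀ v, s.read 6 n v ≤ 3) (hdom : Dominated G (s.read 6 n)) :
    Does B 14 extend s fun s' =>
      (s'.var 20 = 0 → ∃ χ : G.Coloring (Fin 3), ∀ v : Fin n, s'.arr 6 v = (χ v : ℕ)) ∧
      ((∃ χ : G.Coloring (Fin 3), Below (s.read 6 n) χ) → s'.var 20 = 0) := by
  refine Does.seq (i := 12) (j := 5) hB (R := fun s' => Improves G (s.read 6 n) (s'.read 6 n) ∧
    ((∃ χ : G.Coloring (Fin 3), Below (s.read 6 n) χ) → ∀ v : Fin n, (v : ℕ) < n →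
      s'.read 6 n v ≠ 3)) ?_ ?_
  · refine Does.forLoop hB (fun i s' => Improves G (s.read 6 n) (s'.read 6 n) ∧
      ((∃ χ : G.Coloring (Fin 3), Below (s.read 6 n) χ) → ∀ v : Fin n, (v : ℕ) < i →
        s'.read 6 n v ≠ 3)) hn (by decide) hr.size (fun _ _ _ h => h) ⟨.refl hle, by simp⟩ ?_
    rintro i hi s₁ hv hf₁ ⟨him₁, hI₁⟩
    have hr₁ := hr.frame hf₁
    refine Does.mono (Q := fun s' => Improves G (s₁.read 6 n) (s'.read 6 n) ∧
      (s'.read 6 n ⟨i, hi⟩ ≠ 3 ∨ s'.read 6 n = s₁.read 6 n ∧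
        ∀ χ : G.Coloring (Fin 3), Below (s₁.read 6 n) χ → 3 ≤ (χ ⟨i, hi⟩ : ℕ))) ?_ ?_
    · refine Does.forLoop hB (fun j s' => Improves G (s₁.read 6 n) (s'.read 6 n) ∧
        (s'.read 6 n ⟨i, hi⟩ ≠ 3 ∨ s'.read 6 n = s₁.read 6 n ∧
          ∀ χ : G.Coloring (Fin 3), Below (s₁.read 6 n) χ → j ≤ (χ ⟨i, hi⟩ : ℕ))) (by omega)
        (by decide) (by rw [hf₁.var 11 rfl, h11]) (fun _ _ _ h => h)
        ⟨.refl him₁.le, .inr ⟨rfl, by simp⟩⟩ ?_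
      rintro j hj s₂ hc hf₂ ⟨him₂, hI₂⟩
      refine (probe_spec hB hn (hr₁.frame hf₂) him₂.le (him₂.dominated (him₁.dominated hdom))
        (v := ⟨i, hi⟩) (by rw [hf₂.var 17 rfl, hv]) (by omega)).mono ?_
      rintro s₃ - ⟨him₃, hI₃⟩
      refine ⟨him₂.trans him₃, ?_⟩
      rcases hI₃ with h | ⟨h, h'⟩
      · exact .inl h
      · rcases hI₂ with h2 | ⟨h2, h2'⟩
        · exact .inl (by rwa [h])
        · refine .inr ⟨h.trans h2, fun χ hχ => ?_⟩
          have h3 := h' χ (by rwa [h2])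
          have h4 := h2' χ hχ
          omega
    · rintro s₃ - ⟨him₃, hI₃⟩
      refine ⟨him₁.trans him₃, fun hχ v hv => ?_⟩
      rcases Nat.lt_succ_iff_lt_or_eq.1 hv with h' | h'
      · have := hI₁ hχ v h'
        rwa [him₃.eq_of_ne v this]
      · obtain rfl : v = ⟨i, hi⟩ := Fin.ext h'
        rcases hI₃ with h | ⟨-, h⟩
        · exact h
        · obtain ⟨χ, hχ⟩ := him₁.exists_below hχ
          have := h χ hχ
          omega
  rintro s₁ hf₁ ⟨him, htot⟩
  have hr₁ := hr.frame hf₁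
  refine Does.seq (i := 4) (j := 2) hB (check_spec hB hn hr₁ 6) ?_
  intro s₂ hf₂ hp
  have hr₂ := hr₁.frame hf₂
  have h6₂ : s₂.arr 6 = s₁.arr 6 := hf₂.arr 6 rfl
  refine Does.mono (Q := fun s' => s'.var 20 = 0 ↔ Proper G (s₁.read 6 n) ∧
    ∀ v : Fin n, (v : ℕ) < n → s₁.read 6 n v ≠ 3) ?_ ?_
  · refine Does.forLoop hB (fun i s' => s'.var 20 = 0 ↔ Proper G (s₁.read 6 n) ∧
      ∀ v : Fin n, (v : ℕ) < i → s₁.read 6 n v ≠ 3) hn (by decide) hr₂.size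
      (fun _ _ _ h => by simpa using h) (by simpa using hp) ?_
    intro i hi s₃ hu hf₃ hI₃
    have hsplit : (∀ v : Fin n, (v : ℕ) < i + 1 → s₁.read 6 n v ≠ 3) ↔
        (∀ v : Fin n, (v : ℕ) < i → s₁.read 6 n v ≠ 3) ∧ s₁.arr 6 i ≠ 3 := by
      refine ⟨fun h => ⟨fun w hw => h w (by omega), h ⟨i, hi⟩ (by simp)⟩, fun h w hw => ?_⟩
      rcases Nat.lt_succ_iff_lt_or_eq.1 hw with h' | h'
      · exact h.1 w h'
      · obtain rfl : w = ⟨i, hi⟩ := Fin.ext h'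
        exact h.2
    have hlei : s₁.arr 6 i ≤ 3 := him.le ⟨i, hi⟩
    refine .exec hB rfl (by decide) ?_
    rw [hsplit, ← and_assoc, ← hI₃]
    simp only [Program.exec, Expr.eval, hu, hf₃.arr 6 rfl, h6₂]
    split_ifs with h
    · simp
      omega
    · simp
      omega
  · rintro s₃ hf₃ h
    have h6₃ : s₃.arr 6 = s₁.arr 6 := by rw [hf₃.arr 6 rfl, h6₂]
    rw [h]
    constructor
    · rintro ⟨hp, ht⟩
      have hlt : ∀ v, s₁.read 6 n v < 3 := fun v => by
        have h1 := him.le v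
        have h2 := ht v v.2
        omega
      refine ⟨SimpleGraph.Coloring.mk (fun v => ⟨s₁.read 6 n v, hlt v⟩) ?_, fun v => ?_⟩
      · intro u w huw
        simpa using hp u w huw (hlt u)
      · rw [h6₃]
        rfl
    · intro hχ
      refine ⟨fun u w huw hu h => ?_, htot hχ⟩
      obtain ⟨χ, hχ⟩ := him.exists_below hχ
      have h1 := hχ u (by omega)
      have h2 := hχ w (by omega)
      exact χ.valid huw (Fin.ext (by omega))

end RAM

/-! ### Enumerating the colorings of a dominating list -/

theorem Nat.exists_lt_pow_digits (K : ℕ) (c : ℕ → ℕ) (hc : ∀ i < K, c i < 3) :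
    ∃ m < 3 ^ K, ∀ i < K, m / 3 ^ i % 3 = c i := by
  induction K generalizing c with
  | zero => exact ⟨0, by simp, by simp⟩
  | succ K ih =>
    obtain ⟨m, hm, h⟩ := ih (fun i => c (i + 1)) fun i hi => hc (i + 1) (by omega)
    have h0 := hc 0 (by omega)
    refine ⟨c 0 + 3 * m, by rw [pow_succ]; omega, fun i hi => ?_⟩
    rcases i with - | i
    · simp; omega
    · rw [pow_succ', ← Nat.div_div_eq_div_mul, show (c 0 + 3 * m) / 3 = m by omega]
      exact h i (by omega)

namespace RAM

open PartialColoring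

variable {n B : ℕ} {G : SimpleGraph (Fin n)} {s s' : State}

/-- Register `4` holds the length of a list of vertices in the array `2`, and every vertex belongs to
the list or has a neighbor in it. -/
structure IsDominatingList (G : SimpleGraph (Fin n)) (s : State) : Prop where
  lt : ∀ i < s.var 4, s.arr 2 i < n
  dom : ∀ v : Fin n, ∃ i < s.var 4, s.arr 2 i = v ∨ ∃ w : Fin n, s.arr 2 i = w ∧ G.Adj v w

theorem IsDominatingList.frame {p : Program} (h : IsDominatingList G s) (hf : Frame p s s')
    (h4 : p.writesVar 4 = false := by rfl) (h2 : p.writesArr 2 = false := by rfl) :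
    IsDominatingList G s' := by
  refine ⟨?_, ?_⟩
  · rw [hf.var 4 h4, hf.arr 2 h2]
    exact h.lt
  · rw [hf.var 4 h4, hf.arr 2 h2]
    exact h.dom

/-- Divide register `14` by `3`, leaving the remainder there and the quotient in register `15`. -/
def divThree : Program :=
  .seq (.seq (.assign 15 (.const 0)) (.assign 10 (.var 14)))
    (.forLoop 19 10 (.ite (.sub (.var 14) (.const 2))
      (.seq (.assign 14 (.sub (.var 14) (.const 3))) (.assign 15 (.add (.var 15) (.const 1))))
      .skip))

theorem divThree_spec (hB : 100 ≤ B) (hs : s.var 14 + 10 ≤ B) :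
    Does B 3 divThree s fun s' => s'.var 14 = s.var 14 % 3 ∧ s'.var 15 = s.var 14 / 3 := by
  refine Does.seq (i := 1) (j := 2) hB (R := fun s' => s'.var 14 = s.var 14 ∧ s'.var 15 = 0 ∧
    s'.var 10 = s.var 14) (.exec hB rfl (by decide) (by simp [Program.exec, Expr.eval])) ?_
  rintro s₁ hf₁ ⟨h14, h15, h10⟩
  -- The number of rounds is the initial value `z`, more than enough. If the quotient equals `z`,
  -- then `r + 3 * z = z` for the remainder `r`, so both vanish and the remainder is below 3 in this
  -- case too.
  refine Does.mono (Q := fun s' => s'.var 14 + 3 * s'.var 15 = s.var 14 ∧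
    (s'.var 14 < 3 ∨ s'.var 15 = s.var 14)) ?_ fun s' _ h => by omega
  refine Does.forLoop hB (fun i s' => s'.var 14 + 3 * s'.var 15 = s.var 14 ∧
    (s'.var 14 < 3 ∨ s'.var 15 = i)) hs (by decide) h10 (fun _ _ _ h => by simpa using h)
    (by simp [h14, h15]) ?_
  rintro i hi s₂ - - ⟨h1, h2⟩
  refine .exec hB rfl (by decide) ?_
  by_cases h : s₂.var 14 - 2 = 0
  · simp only [Program.exec, Expr.eval, h, if_true]
    omega
  · simp [Program.exec, Expr.eval, h]
    omega

/-- Color the vertices of the list in the array `2` by the ternary digits of register `13`. -/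
def decode : Program :=
  .seq (.forLoop 1 0 (.store 6 (.var 1) (.const 3))) (.seq (.assign 14 (.var 13))
    (.forLoop 16 4 (.seq divThree
      (.seq (.store 6 (.get 2 (.var 16)) (.var 14)) (.assign 14 (.var 15))))))

/-- The list may repeat vertices, and later digits then overwrite earlier ones. This is harmless,
since `χ` is only compared with numbers whose digits agree with it at every index. -/
theorem decode_spec (hB : 100 ≤ B) (hn : n + 10 ≤ B) (hr : Ready G s)
    (hd : IsDominatingList G s) (hK : s.var 4 + 10 ≤ B) (hm : s.var 13 + 10 ≤ B) :
    Does B 7 decode s fun s' => (∀ v, s'.read 6 n v ≤ 3) ∧ Dominated G (s'.read 6 n) ∧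
      ∀ χ : G.Coloring (Fin 3), (∀ i < s.var 4, ∀ v : Fin n, s.arr 2 i = v →
        s.var 13 / 3 ^ i % 3 = (χ v : ℕ)) → Below (s'.read 6 n) χ := by
  refine Does.seq (i := 2) (j := 6) hB (R := fun s' => ∀ v : ℕ, v < n → s'.arr 6 v = 3) ?_ ?_
  · refine Does.forLoop hB (fun i s' => ∀ v : ℕ, v < i → s'.arr 6 v = 3) hn (by decide) hr.size
      (fun _ _ _ h => h) (by simp) ?_
    intro i hi s₁ hx hf hI
    refine .exec hB rfl (by decide) ?_
    intro v hv
    by_cases h : v = i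
    · simp [Program.exec, Expr.eval, hx, h]
    · simp [Program.exec, Expr.eval, hx, h, hI v (by omega)]
  intro s₁ hf₁ h₁
  refine Does.seq (i := 1) (j := 5) hB
    (R := fun s' => s'.var 14 = s.var 13 ∧ ∀ v : ℕ, v < n → s'.arr 6 v = 3)
    (.exec hB rfl (by decide) ⟨?_, ?_⟩) ?_
  · simp [Program.exec, Expr.eval, hf₁.var 13 rfl]
  · simpa [Program.exec] using h₁
  rintro s₂ hf₂ ⟨h14, h₂⟩
  have hK₂ : s₂.var 4 = s.var 4 := by rw [hf₂.var 4 rfl, hf₁.var 4 rfl]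
  have hA₂ : s₂.arr 2 = s.arr 2 := by rw [hf₂.arr 2 rfl, hf₁.arr 2 rfl]
  refine Does.mono (Q := fun s' => s'.var 14 = s.var 13 / 3 ^ s.var 4 ∧
    (∀ v : Fin n, s'.arr 6 v ≤ 3) ∧ (∀ i < s.var 4, s'.arr 6 (s.arr 2 i) < 3) ∧
      ∀ χ : G.Coloring (Fin 3), (∀ i < s.var 4, ∀ v : Fin n, s.arr 2 i = v →
        s.var 13 / 3 ^ i % 3 = (χ v : ℕ)) → Below (s'.read 6 n) χ) ?_ ?_
  · refine Does.forLoop hB (fun j s' => s'.var 14 = s.var 13 / 3 ^ j ∧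
      (∀ v : Fin n, s'.arr 6 v ≤ 3) ∧ (∀ i < j, s'.arr 6 (s.arr 2 i) < 3) ∧
        ∀ χ : G.Coloring (Fin 3), (∀ i < j, ∀ v : Fin n, s.arr 2 i = v →
          s.var 13 / 3 ^ i % 3 = (χ v : ℕ)) → Below (s'.read 6 n) χ) hK (by decide) hK₂
      (fun _ _ _ h => by simpa using h) ?_ ?_
    · refine ⟨by simp [h14], fun v => (h₂ v v.2).le, by simp, fun χ _ v hv => ?_⟩
      exact absurd (h₂ v v.2) hv
    rintro j hj s₃ h16 hf₃ ⟨h14₃, hle, hlt, hbel⟩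
    have hz : s₃.var 14 + 10 ≤ B := by
      have := Nat.div_le_self (s.var 13) (3 ^ j)
      omega
    refine Does.seq (i := 3) (j := 1) hB (divThree_spec hB hz) ?_
    rintro s₄ hf₄ ⟨hmod, hdiv⟩
    refine .exec hB rfl (by decide) ?_
    have hA₄ : s₄.arr 2 = s.arr 2 := by rw [hf₄.arr 2 rfl, hf₃.arr 2 rfl, hA₂]
    have h6 : ∀ v, (Program.exec (.seq (.store 6 (.get 2 (.var 16)) (.var 14))
        (.assign 14 (.var 15))) s₄).arr 6 v =
        if v = s.arr 2 j then s.var 13 / 3 ^ j % 3 else s₃.arr 6 v := by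
      intro v
      simp [Program.exec, Expr.eval, hf₄.var 16 rfl, hf₄.arr 6 rfl, h16, hmod, h14₃, hA₄]
    have h14₄ : (Program.exec (.seq (.store 6 (.get 2 (.var 16)) (.var 14))
        (.assign 14 (.var 15))) s₄).var 14 = s.var 13 / 3 ^ (j + 1) := by
      simp [Program.exec, Expr.eval, hdiv, h14₃, Nat.div_div_eq_div_mul, pow_succ]
    refine ⟨h14₄, fun v => ?_, fun i hi => ?_, fun χ hχ v hv => ?_⟩
    · rw [h6]
      split_ifs
      · omega
      · exact hle v
    · rw [h6]
      split_ifs with h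
      · omega
      · exact hlt i (lt_of_le_of_ne (by omega) fun h' => h (by rw [h']))
    · simp only [State.read] at hv ⊢
      rw [h6] at hv ⊢
      split_ifs at hv ⊢ with h
      · exact hχ j (by omega) v h.symm
      · exact hbel χ (fun i hi => hχ i (by omega)) v hv
  · rintro s₃ - ⟨-, hle, hlt, hbel⟩
    refine ⟨hle, fun v hv => ?_, hbel⟩
    obtain ⟨i, hi, h | ⟨w, hw, hvw⟩⟩ := hd.dom v
    · have := hlt i hi
      rw [h] at this
      exact absurd hv this.ne
    · refine ⟨w, hvw, ?_⟩
      have := hlt i hi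
      rw [hw] at this
      exact this.ne

/-- Try all colorings of the list in the array `2`. Register `12` must hold their number. -/
def enumerate : Program :=
  .forLoop 13 12 (.seq decode (.seq extend
    (.ite (.var 20) .skip (.seq (.assign 21 (.const 1)) (copyArr 6 1 0)))))

theorem enumerate_spec (hB : 100 ≤ B) (hn : n + 10 ≤ B) (hr : Ready G s)
    (hd : IsDominatingList G s) (hK : s.var 4 + 10 ≤ B) (hP : 3 ^ s.var 4 + 10 ≤ B)
    (h11 : s.var 11 = 3) (h12 : s.var 12 = 3 ^ s.var 4) (h21 : s.var 21 = 0) :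
    Does B 17 enumerate s fun s' =>
      (s'.var 21 = 1 ∧ ∃ χ : G.Coloring (Fin 3), ∀ v : Fin n, s'.arr 1 v = (χ v : ℕ)) ∨
      (s'.var 21 = 0 ∧ ¬ G.Colorable 3) := by
  refine Does.mono (Q := fun s' =>
    (s'.var 21 = 1 ∧ ∃ χ : G.Coloring (Fin 3), ∀ v : Fin n, s'.arr 1 v = (χ v : ℕ)) ∨
    (s'.var 21 = 0 ∧ ∀ χ : G.Coloring (Fin 3), ∀ m < 3 ^ s.var 4, ¬ ∀ i < s.var 4, ∀ v : Fin n,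
      s.arr 2 i = v → m / 3 ^ i % 3 = (χ v : ℕ))) ?_ ?_
  · refine Does.forLoop hB (fun j s' =>
      (s'.var 21 = 1 ∧ ∃ χ : G.Coloring (Fin 3), ∀ v : Fin n, s'.arr 1 v = (χ v : ℕ)) ∨
      (s'.var 21 = 0 ∧ ∀ χ : G.Coloring (Fin 3), ∀ m < j, ¬ ∀ i < s.var 4, ∀ v : Fin n,
        s.arr 2 i = v → m / 3 ^ i % 3 = (χ v : ℕ))) hP (by decide) h12
      (fun _ _ _ h => by simpa using h) (.inr ⟨h21, by simp⟩) ?_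
    intro j hj s₁ h13 hf₁ hI
    have hr₁ := hr.frame hf₁
    have hd₁ := hd.frame hf₁
    have hK₁ : s₁.var 4 = s.var 4 := hf₁.var 4 rfl
    refine Does.seq (i := 7) (j := 15) hB
      (decode_spec hB hn hr₁ hd₁ (by omega) (by omega)) ?_
    rintro s₂ hf₂ ⟨hle, hdom, hbel⟩
    have hr₂ := hr₁.frame hf₂
    rw [hK₁, hf₁.arr 2 rfl, h13] at hbel
    refine Does.seq (i := 14) (j := 5) hB (extend_spec hB hn hr₂
      (by rw [hf₂.var 11 rfl, hf₁.var 11 rfl, h11]) hle hdom) ?_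
    rintro s₃ hf₃ ⟨hgood, hbad⟩
    have hr₃ := hr₂.frame hf₃
    refine Does.ite (i := 1) (j := 4) hB (by decide) (fun he => ?_) (fun he => ?_)
    · refine .exec hB rfl (by decide) ?_
      simp only [Program.exec, hf₃.var 21 rfl, hf₂.var 21 rfl, hf₃.arr 1 rfl, hf₂.arr 1 rfl]
      rcases hI with hI | ⟨hI, hI'⟩
      · exact .inl hI
      · refine .inr ⟨hI, fun χ m hm h => ?_⟩
        rcases Nat.lt_succ_iff_lt_or_eq.1 hm with hm | rfl
        · exact hI' χ m hm h
        · exact he (hbad ⟨χ, hbel χ h⟩)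
    · refine Does.seq (i := 1) (j := 2) hB (R := fun s' => s'.var 21 = 1 ∧ s'.arr 6 = s₃.arr 6)
        (.exec hB rfl (by decide) (by simp [Program.exec, Expr.eval])) ?_
      rintro s₄ hf₄ ⟨h21₄, h6⟩
      refine (copyArr_spec hB hn (hr₃.frame hf₄).size (by decide) (by decide)).mono ?_
      rintro s₅ hf₅ h₅
      obtain ⟨χ, hχ⟩ := hgood he
      refine .inl ⟨by rw [hf₅.var 21 rfl, h21₄], χ, fun v => ?_⟩
      rw [h₅ v v.2, h6, hχ]
  · rintro s₁ - (h | ⟨h, h'⟩)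
    · exact .inl h
    · refine .inr ⟨h, fun ⟨χ⟩ => ?_⟩
      -- The digits of `m` spell out the colors of `χ` along the list; the default `0` is never met
      -- at an index inside the list.
      obtain ⟨m, hm, hc⟩ := Nat.exists_lt_pow_digits (s.var 4)
        (fun i => if hi : s.arr 2 i < n then (χ ⟨s.arr 2 i, hi⟩ : ℕ) else 0) (by
          intro i hi
          simp [hd.lt i hi])
      refine h' χ m hm fun i hi v hv => ?_
      rw [hc i hi]
      simp [hv]

end RAM

/-- The induction step for loops that count vertices one at a time. -/
theorem Fin.card_filter_lt_succ {n j : ℕ} (hj : j < n) (P : Fin n → Prop) [DecidablePred P] :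
    (Finset.univ.filter fun w : Fin n => (w : ℕ) < j + 1 ∧ P w).card =
      (Finset.univ.filter fun w : Fin n => (w : ℕ) < j ∧ P w).card +
        if P ⟨j, hj⟩ then 1 else 0 := by
  have hlt : ∀ w : Fin n, (w : ℕ) < j + 1 ↔ w = ⟨j, hj⟩ ∨ (w : ℕ) < j := by
    intro w
    rw [Fin.ext_iff]
    change _ ↔ (w : ℕ) = j ∨ _
    omega
  split_ifs with h
  · rw [← Finset.card_insert_of_notMem (a := ⟨j, hj⟩) (by simp)]
    congr 1
    ext w
    simp only [Finset.mem_filter, Finset.mem_univ, true_and, Finset.mem_insert, hlt]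
    constructor
    · rintro ⟨rfl | h1, h2⟩
      · exact .inl rfl
      · exact .inr ⟨h1, h2⟩
    · rintro (rfl | ⟨h1, h2⟩)
      · exact ⟨.inl rfl, h⟩
      · exact ⟨.inr h1, h2⟩
  · rw [add_zero]
    congr 1
    ext w
    simp only [Finset.mem_filter, Finset.mem_univ, true_and, hlt]
    constructor
    · rintro ⟨rfl | h1, h2⟩
      · exact absurd h2 h
      · exact ⟨h1, h2⟩
    · rintro ⟨h1, h2⟩
      exact ⟨.inr h1, h2⟩

/-! ### Dominating lists -/

namespace RAM

variable {n B : ℕ} {G : SimpleGraph (Fin n)} {s s' : State}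

/-- Compute where the rows of the adjacency matrix begin. -/
def rows : Program :=
  .forLoop 1 0 (.seq (.store 4 (.var 1) (.var 6)) (.assign 6 (.add (.var 6) (.var 0))))

theorem inputState_arr_zero (G : SimpleGraph (Fin n)) (u v : Fin n) :
    (inputState G).arr 0 (u * n + v) ≠ 0 ↔ G.Adj u v := by
  classical
  simp only [inputState, true_and, ne_eq, ite_eq_right_iff, one_ne_zero, imp_false, not_not]
  constructor
  · rintro ⟨u', v', h, hadj⟩
    have hn : 0 < n := u.pos
    have h1 : (u : ℕ) = u' := by
      have := congrArg (· / n) h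
      simpa [mul_comm _ n, Nat.mul_add_div hn, Nat.div_eq_of_lt] using this
    have h2 : (v : ℕ) = v' := by rw [h1] at h; omega
    rwa [Fin.ext h1, Fin.ext h2]
  · exact fun h => ⟨u, v, rfl, h⟩

/-- Without multiplication the offsets `u * n` are accumulated by repeated addition in register `6`.
-/
theorem rows_spec (hB : 100 ≤ B) (hn : n + 10 ≤ B) (G : SimpleGraph (Fin n)) :
    Does B 2 rows (inputState G) (Ready G) := by
  refine Does.mono (Q := fun s => s.var 6 = n * n ∧ ∀ u < n, s.arr 4 u = u * n) ?_ ?_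
  · refine Does.forLoop hB (fun i s => s.var 6 = i * n ∧ ∀ u < i, s.arr 4 u = u * n) hn
      (by decide) rfl (fun _ _ _ h => by simpa using h) ⟨by simp [inputState], by simp⟩ ?_
    rintro i hi s hx hf ⟨h6, h4⟩
    have h0 : s.var 0 = n := hf.var 0 rfl
    refine .exec hB rfl (by decide) ⟨?_, fun u hu => ?_⟩
    · simp [Program.exec, Expr.eval, h6, h0, add_mul]
    · by_cases h : u = i
      · simp [Program.exec, Expr.eval, hx, h, h6]
      · simp [Program.exec, Expr.eval, hx, h, h4 u (by omega)]
  · rintro s hf ⟨-, h⟩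
    refine ⟨hf.var 0 rfl, fun u v => ?_⟩
    rw [h u u.2, hf.arr 0 rfl]
    exact inputState_arr_zero G u v

/-- Append the vertex in register `3` to the list in the array `3` if it can be reached from the
vertex in register `17` through the vertex in register `2`. -/
def pushTwoStep : Program :=
  .when (adjExpr 17 2) (.when (adjExpr 2 3)
    (.seq (.store 3 (.var 5) (.var 3)) (.assign 5 (.add (.var 5) (.const 1)))))

/-- List in the array `3`, with its length in register `5`, the neighbors of the neighbors of the
vertex in register `17`. -/
def ballList : Program :=
  .seq (.assign 5 (.const 0)) (.forLoop 2 0 (.forLoop 3 0 pushTwoStep))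

/-- One entry is written for each walk of length 2 from `u`, with repetitions; each neighbor of `u`
contributes at most `G.maxDegree` of them. -/
theorem ballList_spec [DecidableRel G.Adj] (hB : 100 ≤ B) (hn : n + 10 ≤ B) (hr : Ready G s)
    {u : Fin n} (hu : s.var 17 = u) :
    Does B 4 ballList s fun s' => s'.var 5 ≤ G.degree u * G.maxDegree ∧
      (∀ i < s'.var 5, s'.arr 3 i < n) ∧
      ∀ x w : Fin n, G.Adj u x → G.Adj x w → ∃ i < s'.var 5, s'.arr 3 i = w := by
  refine Does.seq (i := 1) (j := 3) hB (R := fun s' => s'.var 5 = 0)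
    (.exec hB rfl (by decide) rfl) ?_
  intro s₀ hf₀ h₀
  have hr₀ := hr.frame hf₀
  refine Does.mono (Q := fun s' =>
    s'.var 5 ≤ (Finset.univ.filter fun x : Fin n => (x : ℕ) < n ∧ G.Adj u x).card * G.maxDegree ∧
      (∀ i < s'.var 5, s'.arr 3 i < n) ∧
      ∀ x w : Fin n, (x : ℕ) < n → G.Adj u x → G.Adj x w → ∃ i < s'.var 5, s'.arr 3 i = w) ?_ ?_
  · refine Does.forLoop hB (fun j s' =>
      s'.var 5 ≤ (Finset.univ.filter fun x : Fin n => (x : ℕ) < j ∧ G.Adj u x).card *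
        G.maxDegree ∧ (∀ i < s'.var 5, s'.arr 3 i < n) ∧
      ∀ x w : Fin n, (x : ℕ) < j → G.Adj u x → G.Adj x w → ∃ i < s'.var 5, s'.arr 3 i = w) hn
      (by decide) hr₀.size (fun _ _ _ h => by simpa using h) (by simp [h₀]) ?_
    rintro i hi s₁ hx hf₁ ⟨hL₁, hlt₁, hI₁⟩
    have hr₁ := hr₀.frame hf₁
    refine Does.mono (Q := fun s' => s'.var 5 ≤ s₁.var 5 + (Finset.univ.filter fun w : Fin n =>
        (w : ℕ) < n ∧ G.Adj u ⟨i, hi⟩ ∧ G.Adj ⟨i, hi⟩ w).card ∧ s₁.var 5 ≤ s'.var 5 ∧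
        (∀ k < s₁.var 5, s'.arr 3 k = s₁.arr 3 k) ∧ (∀ i < s'.var 5, s'.arr 3 i < n) ∧
        ∀ w : Fin n, (w : ℕ) < n → G.Adj u ⟨i, hi⟩ → G.Adj ⟨i, hi⟩ w →
          ∃ k < s'.var 5, s'.arr 3 k = w) ?_ ?_
    · refine Does.forLoop hB (fun j s' =>
        s'.var 5 ≤ s₁.var 5 + (Finset.univ.filter fun w : Fin n =>
          (w : ℕ) < j ∧ G.Adj u ⟨i, hi⟩ ∧ G.Adj ⟨i, hi⟩ w).card ∧ s₁.var 5 ≤ s'.var 5 ∧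
        (∀ k < s₁.var 5, s'.arr 3 k = s₁.arr 3 k) ∧ (∀ i < s'.var 5, s'.arr 3 i < n) ∧
        ∀ w : Fin n, (w : ℕ) < j → G.Adj u ⟨i, hi⟩ → G.Adj ⟨i, hi⟩ w →
          ∃ k < s'.var 5, s'.arr 3 k = w) hn (by decide) hr₁.size
        (fun _ _ _ h => by simpa using h) ⟨by simp, le_rfl, by simp, hlt₁, by simp⟩ ?_
      rintro j hj s₂ hw hf₂ ⟨hL₂, hle₂, heq₂, hlt₂, hI₂⟩
      have hr₂ := hr₁.frame hf₂
      have hu₂ : s₂.var 17 = u := by rw [hf₂.var 17 rfl, hf₁.var 17 rfl, hf₀.var 17 rfl, hu]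
      have hx₂ : s₂.var 2 = i := by rw [hf₂.var 2 rfl, hx]
      have h1 := hr₂.eval_adjExpr (u := u) (v := ⟨i, hi⟩) hu₂ hx₂
      have h2 := hr₂.eval_adjExpr (u := ⟨i, hi⟩) (v := ⟨j, hj⟩) hx₂ hw
      refine .exec hB rfl (by decide) ?_
      rw [Fin.card_filter_lt_succ hj]
      by_cases h : G.Adj u ⟨i, hi⟩ ∧ G.Adj ⟨i, hi⟩ ⟨j, hj⟩
      · rw [if_pos h]
        have he : pushTwoStep.exec s₂ =
            (s₂.setArr 3 (s₂.var 5) j).setVar 5 (s₂.var 5 + 1) := by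
          simp [pushTwoStep, Program.when, Program.exec, h1, h2, h.1, h.2, Expr.eval, hw]
        rw [he]
        simp only [State.setVar_var, State.setVar_arr, State.setArr_arr, State.setArr_var,
          if_true, true_and]
        refine ⟨by omega, by omega, fun k hk => ?_, fun k hk => ?_, fun w hwj ha hb => ?_⟩
        · rw [if_neg (by omega), heq₂ k hk]
        · split_ifs with hk'
          · exact hj
          · exact hlt₂ k (by omega)
        · rcases Nat.lt_succ_iff_lt_or_eq.1 hwj with h' | h'
          · obtain ⟨k, hk, hkw⟩ := hI₂ w h' ha hb
            exact ⟨k, by omega, by rw [if_neg (by omega), hkw]⟩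
          · exact ⟨s₂.var 5, by omega, by rw [if_pos rfl, h']⟩
      · rw [if_neg h]
        have he : pushTwoStep.exec s₂ = s₂ := by
          simp only [pushTwoStep, Program.when, Program.exec, h1, h2]
          by_cases a : G.Adj u ⟨i, hi⟩
          · have b : ¬ G.Adj ⟨i, hi⟩ ⟨j, hj⟩ := fun b => h ⟨a, b⟩
            simp [b]
          · simp [a]
        rw [he]
        refine ⟨by omega, hle₂, heq₂, hlt₂, fun w hwj ha hb => ?_⟩
        rcases Nat.lt_succ_iff_lt_or_eq.1 hwj with h' | h'
        · exact hI₂ w h' ha hb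
        · obtain rfl : w = ⟨j, hj⟩ := Fin.ext h'
          exact absurd ⟨ha, hb⟩ h
    · rintro s₂ - ⟨hL₂, hle₂, heq₂, hlt₂, hI₂⟩
      refine ⟨hL₂.trans ?_, hlt₂, fun x w hxi ha hb => ?_⟩
      · rw [Fin.card_filter_lt_succ hi, add_mul]
        refine add_le_add hL₁ ?_
        by_cases h : G.Adj u ⟨i, hi⟩
        · rw [if_pos h, one_mul]
          refine le_trans ?_ (G.degree_le_maxDegree ⟨i, hi⟩)
          rw [← SimpleGraph.card_neighborFinset_eq_degree, SimpleGraph.neighborFinset_eq_filter]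
          exact Finset.card_le_card fun w => by simp
        · simp [h]
      · rcases Nat.lt_succ_iff_lt_or_eq.1 hxi with h' | h'
        · obtain ⟨k, hk, hkw⟩ := hI₁ x w h' ha hb
          exact ⟨k, by omega, by rw [heq₂ k hk, hkw]⟩
        · obtain rfl : x = ⟨i, hi⟩ := Fin.ext h'
          exact hI₂ w w.2 ha hb
  · rintro s₁ - ⟨h1, h2, h3⟩
    refine ⟨?_, h2, fun x w => h3 x w x.2⟩
    rw [← SimpleGraph.card_neighborFinset_eq_degree, SimpleGraph.neighborFinset_eq_filter]
    simpa using h1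

/-- Replace the list in the array `2` by a list of the neighbors of the neighbors of some vertex if
such a list is shorter. -/
def shorten : Program :=
  .forLoop 17 0 (.seq ballList (.when (.sub (.var 4) (.var 5))
    (.seq (copyArr 3 2 5) (.assign 4 (.var 5)))))

theorem shorten_spec [DecidableRel G.Adj] (hB : 100 ≤ B) (hn : n * n + n + 10 ≤ B)
    (hr : Ready G s) (hd : IsDominatingList G s)
    (hball : ∀ u v, ∃ x w, G.Adj u x ∧ G.Adj x w ∧ (w = v ∨ G.Adj v w)) :
    Does B 6 shorten s fun s' => IsDominatingList G s' ∧ s'.var 4 ≤ s.var 4 ∧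
      ∀ u, s'.var 4 ≤ G.degree u * G.maxDegree := by
  refine Does.mono (Q := fun s' => IsDominatingList G s' ∧ s'.var 4 ≤ s.var 4 ∧
      ∀ u : Fin n, (u : ℕ) < n → s'.var 4 ≤ G.degree u * G.maxDegree) ?_
    fun s' _ h => ⟨h.1, h.2.1, fun u => h.2.2 u u.2⟩
  refine Does.forLoop hB (fun i s' => IsDominatingList G s' ∧ s'.var 4 ≤ s.var 4 ∧
      ∀ u : Fin n, (u : ℕ) < i → s'.var 4 ≤ G.degree u * G.maxDegree) (by omega) (by decide)
      hr.size (fun _ _ _ h => ⟨⟨by simpa using h.1.lt, by simpa using h.1.dom⟩, h.2⟩)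
      ⟨hd, le_rfl, by simp⟩ ?_
  rintro i hi s₁ hx hf₁ ⟨hd₁, hle₁, hI₁⟩
  have hr₁ := hr.frame hf₁
  refine Does.seq (i := 4) (j := 4) hB
    (ballList_spec hB (by omega) hr₁ (u := ⟨i, hi⟩) hx) ?_
  rintro s₂ hf₂ ⟨hL, hlt, hI⟩
  have hd₂ := hd₁.frame hf₂
  have h4 : s₂.var 4 = s₁.var 4 := hf₂.var 4 rfl
  -- Because of repetitions the list can be longer than `n`; copying it is the reason for the term
  -- `n * n` in the base `B`.
  have hLn : s₂.var 5 ≤ n * n := by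
    refine hL.trans (Nat.mul_le_mul ?_ ?_)
    · simpa using (G.degree_lt_card_verts ⟨i, hi⟩).le
    · refine SimpleGraph.maxDegree_le_of_forall_degree_le G n fun v => ?_
      simpa using (G.degree_lt_card_verts v).le
  refine Does.ite (i := 3) (j := 1) hB (by decide) (fun he => ?_) (fun he => ?_)
  · simp only [Expr.eval] at he
    refine Does.seq (i := 2) (j := 1) hB
      (copyArr_spec hB (N := s₂.var 5) (by omega) rfl (by decide) (by decide)) ?_
    intro s₃ hf₃ h₃
    refine .exec hB rfl (by decide) ?_
    simp only [Program.exec, Expr.eval, hf₃.var 5 rfl]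
    simp only [State.setVar_var, if_true]
    refine ⟨⟨?_, ?_⟩, by omega, fun u hu => ?_⟩
    · simp only [State.setVar_var, State.setVar_arr, if_true]
      intro k hk
      rw [h₃ k hk]
      exact hlt k hk
    · simp only [State.setVar_var, State.setVar_arr, if_true]
      intro v
      obtain ⟨x, w, hux, hxw, hw⟩ := hball ⟨i, hi⟩ v
      obtain ⟨k, hk, hkw⟩ := hI x w hux hxw
      refine ⟨k, hk, ?_⟩
      rw [h₃ k hk, hkw]
      rcases hw with rfl | hw
      · exact .inl rfl
      · exact .inr ⟨w, rfl, hw⟩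
    · rcases Nat.lt_succ_iff_lt_or_eq.1 hu with h' | h'
      · exact le_trans (by omega) (hI₁ u h')
      · obtain rfl : u = ⟨i, hi⟩ := Fin.ext h'
        exact hL
  · simp only [Expr.eval] at he
    refine .exec hB rfl (by decide) ⟨hd₂, by simp only [Program.exec]; omega, fun u hu => ?_⟩
    simp only [Program.exec]
    rcases Nat.lt_succ_iff_lt_or_eq.1 hu with h' | h'
    · rw [h4]
      exact hI₁ u h'
    · obtain rfl : u = ⟨i, hi⟩ := Fin.ext h'
      omega

end RAM

/-! ### The greedy dominating list -/

namespace RAM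

variable {n B : ℕ} {G : SimpleGraph (Fin n)} {s s' : State}

/-- The vertices that are not marked in the array `5`. -/
def unmarked (s : State) (n : ℕ) : Finset (Fin n) := Finset.univ.filter fun v => s.arr 5 v = 0

@[simp] theorem unmarked_setVar (s : State) (x v n : ℕ) :
    unmarked (s.setVar x v) n = unmarked s n := rfl

/-- The number of unmarked neighbors of a vertex. -/
def gain (G : SimpleGraph (Fin n)) [DecidableRel G.Adj] (s : State) (v : Fin n) : ℕ :=
  (Finset.univ.filter fun w => G.Adj v w ∧ s.arr 5 w = 0).card

/-- Double counting of the adjacent pairs with unmarked second vertex: each unmarked vertex is in at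
least `G.minDegree` pairs, each vertex on the other side in at most `b`. -/
theorem minDegree_mul_card_unmarked_le [DecidableRel G.Adj] {b : ℕ} (hb : ∀ v, gain G s v ≤ b) :
    G.minDegree * (unmarked s n).card ≤ n * b := by
  classical
  have h := Finset.sum_card_bipartiteAbove_eq_sum_card_bipartiteBelow (s := Finset.univ)
    (t := unmarked s n) (G.Adj)
  have h1 : ∀ v, (Finset.bipartiteAbove G.Adj (unmarked s n) v).card ≤ b := by
    intro v
    refine le_trans (Finset.card_le_card fun w => ?_) (hb v)
    simp only [Finset.bipartiteAbove, unmarked, Finset.mem_filter, Finset.mem_univ, true_and]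
    exact And.symm
  have h2 : ∀ w, G.minDegree ≤ (Finset.bipartiteBelow G.Adj Finset.univ w).card := by
    intro w
    refine (G.minDegree_le_degree w).trans ?_
    rw [← SimpleGraph.card_neighborFinset_eq_degree, SimpleGraph.neighborFinset_eq_filter]
    refine Finset.card_le_card fun v => ?_
    simp only [Finset.bipartiteBelow, Finset.mem_filter, Finset.mem_univ, true_and]
    exact SimpleGraph.Adj.symm
  calc G.minDegree * (unmarked s n).card
      = ∑ _w ∈ unmarked s n, G.minDegree := by simp [mul_comm]
    _ ≤ ∑ w ∈ unmarked s n, (Finset.bipartiteBelow G.Adj Finset.univ w).card :=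
        Finset.sum_le_sum fun w _ => h2 w
    _ = ∑ v : Fin n, (Finset.bipartiteAbove G.Adj (unmarked s n) v).card := h.symm
    _ ≤ ∑ _v : Fin n, b := Finset.sum_le_sum fun v _ => h1 v
    _ = n * b := by simp

/-- Count in register `9` the unmarked neighbors of the vertex in register `17`. -/
def countUnmarked : Program :=
  .seq (.assign 9 (.const 0)) (.forLoop 3 0 (.when (adjExpr 17 3)
    (.ite (.get 5 (.var 3)) .skip (.assign 9 (.add (.var 9) (.const 1))))))

theorem countUnmarked_spec [DecidableRel G.Adj] (hB : 100 ≤ B) (hn : n + 10 ≤ B) (hr : Ready G s)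
    {v : Fin n} (hv : s.var 17 = v) :
    Does B 3 countUnmarked s fun s' => s'.var 9 = gain G s v := by
  refine Does.seq (i := 1) (j := 2) hB (R := fun s' => s'.var 9 = 0)
    (.exec hB rfl (by decide) rfl) ?_
  intro s₀ hf₀ h₀
  have hr₀ := hr.frame hf₀
  refine Does.mono (Q := fun s' => s'.var 9 = (Finset.univ.filter fun w : Fin n =>
    (w : ℕ) < n ∧ G.Adj v w ∧ s.arr 5 w = 0).card) ?_ fun s' _ h => by simpa [gain] using h
  refine Does.forLoop hB (fun j s' => s'.var 9 = (Finset.univ.filter fun w : Fin n =>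
    (w : ℕ) < j ∧ G.Adj v w ∧ s.arr 5 w = 0).card) hn (by decide) hr₀.size
    (fun _ _ _ h => by simpa using h) (by simp [h₀]) ?_
  intro j hj s₁ hw hf₁ hI
  have h1 := (hr₀.frame hf₁).eval_adjExpr (x := 17) (y := 3) (u := v) (v := ⟨j, hj⟩)
    (by rw [hf₁.var 17 rfl, hf₀.var 17 rfl, hv]) hw
  refine .exec hB rfl (by decide) ?_
  rw [Fin.card_filter_lt_succ hj, ← hI]
  simp only [Program.when, Program.exec, h1]
  by_cases a : G.Adj v ⟨j, hj⟩
  · by_cases b : s.arr 5 j = 0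
    · simp [a, b, Expr.eval, hw, hf₁.arr 5 rfl, hf₀.arr 5 rfl]
    · simp [a, b, Expr.eval, hw, hf₁.arr 5 rfl, hf₀.arr 5 rfl]
  · simp [a]

/-- Find a vertex with the largest number of unmarked neighbors, and put it into register `8`, and
the number into register `7`. -/
def pickBest : Program :=
  .seq (.assign 7 (.const 0)) (.forLoop 17 0 (.seq countUnmarked
    (.when (.sub (.var 9) (.var 7)) (.seq (.assign 7 (.var 9)) (.assign 8 (.var 17))))))

theorem pickBest_spec [DecidableRel G.Adj] (hB : 100 ≤ B) (hn : n + 10 ≤ B) (hr : Ready G s) :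
    Does B 6 pickBest s fun s' => (∀ v, gain G s v ≤ s'.var 7) ∧
      (s'.var 7 = 0 ∨ ∃ v : Fin n, s'.var 8 = v ∧ s'.var 7 = gain G s v) := by
  refine Does.seq (i := 1) (j := 5) hB (R := fun s' => s'.var 7 = 0)
    (.exec hB rfl (by decide) rfl) ?_
  intro s₀ hf₀ h₀
  have hr₀ := hr.frame hf₀
  refine Does.mono (Q := fun s' => (∀ v : Fin n, (v : ℕ) < n → gain G s v ≤ s'.var 7) ∧
      (s'.var 7 = 0 ∨ ∃ v : Fin n, s'.var 8 = v ∧ s'.var 7 = gain G s v)) ?_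
    fun s' _ h => ⟨fun v => h.1 v v.2, h.2⟩
  refine Does.forLoop hB (fun j s' => (∀ v : Fin n, (v : ℕ) < j → gain G s v ≤ s'.var 7) ∧
      (s'.var 7 = 0 ∨ ∃ v : Fin n, s'.var 8 = v ∧ s'.var 7 = gain G s v)) hn (by decide) hr₀.size
    (fun _ _ _ h => by simpa using h) ⟨by simp, .inl h₀⟩ ?_
  rintro i hi s₁ hv hf₁ ⟨hI, hI'⟩
  refine Does.seq (i := 3) (j := 1) hB
    (countUnmarked_spec hB hn (hr₀.frame hf₁) (v := ⟨i, hi⟩) hv) ?_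
  intro s₂ hf₂ h9
  have h5 : gain G s₁ ⟨i, hi⟩ = gain G s ⟨i, hi⟩ := by
    simp only [gain, hf₁.arr 5 rfl, hf₀.arr 5 rfl]
  rw [h5] at h9
  have h7 : s₂.var 7 = s₁.var 7 := hf₂.var 7 rfl
  refine .exec hB rfl (by decide) ?_
  by_cases h : s₂.var 9 - s₂.var 7 = 0
  · have he : Program.exec (.when (.sub (.var 9) (.var 7))
        (.seq (.assign 7 (.var 9)) (.assign 8 (.var 17)))) s₂ = s₂ := by
      simp [Program.when, Program.exec, Expr.eval, h]
    rw [he, h7, hf₂.var 8 rfl]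
    refine ⟨fun v hvi => ?_, hI'⟩
    rcases Nat.lt_succ_iff_lt_or_eq.1 hvi with h' | h'
    · exact hI v h'
    · obtain rfl : v = ⟨i, hi⟩ := Fin.ext h'
      omega
  · have he : Program.exec (.when (.sub (.var 9) (.var 7))
        (.seq (.assign 7 (.var 9)) (.assign 8 (.var 17)))) s₂ =
        (s₂.setVar 7 (gain G s ⟨i, hi⟩)).setVar 8 i := by
      rw [h9] at h
      simp [Program.when, Program.exec, Expr.eval, h, h9, hf₂.var 17 rfl, hv]
    rw [he]
    refine ⟨fun v hvi => ?_, .inr ⟨⟨i, hi⟩, by simp, by simp⟩⟩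
    simp only [State.setVar_var, if_true]
    rcases Nat.lt_succ_iff_lt_or_eq.1 hvi with h' | h'
    · have := hI v h'
      simp
      omega
    · obtain rfl : v = ⟨i, hi⟩ := Fin.ext h'
      simp

/-- If register `7` is nonzero, append the vertex in register `8` to the list in the array `2` and
mark its neighbors. -/
def appendBest : Program :=
  .when (.var 7) (.seq
    (.seq (.store 2 (.var 4) (.var 8)) (.assign 4 (.add (.var 4) (.const 1))))
    (.forLoop 3 0 (.when (adjExpr 8 3) (.store 5 (.var 3) (.const 1)))))

theorem appendBest_spec (hB : 100 ≤ B) (hn : n + 10 ≤ B) (hr : Ready G s)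
    (h7 : s.var 7 ≠ 0) {b : Fin n} (hb : s.var 8 = b) :
    Does B 4 appendBest s fun s' => s'.var 4 = s.var 4 + 1 ∧
      (∀ i, s'.arr 2 i = if i = s.var 4 then (b : ℕ) else s.arr 2 i) ∧
      ∀ w : Fin n, s'.arr 5 w = 0 ↔ s.arr 5 w = 0 ∧ ¬ G.Adj b w := by
  refine Does.ite (i := 3) (j := 1) hB (by decide) (fun _ => ?_) (fun he => absurd he h7)
  refine Does.seq (i := 1) (j := 2) hB (R := fun s' => s'.var 4 = s.var 4 + 1 ∧
      (∀ i, s'.arr 2 i = if i = s.var 4 then (b : ℕ) else s.arr 2 i))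
    (.exec hB rfl (by decide) (by simp [Program.exec, Expr.eval, hb])) ?_
  rintro s₁ hf₁ ⟨h4, h2⟩
  have hr₁ := hr.frame hf₁
  refine Does.mono (Q := fun s' => ∀ w : Fin n, s'.arr 5 w = 0 ↔
    s.arr 5 w = 0 ∧ ¬ ((w : ℕ) < n ∧ G.Adj b w)) ?_ ?_
  · refine Does.forLoop hB (fun j s' => ∀ w : Fin n, s'.arr 5 w = 0 ↔
      s.arr 5 w = 0 ∧ ¬ ((w : ℕ) < j ∧ G.Adj b w)) hn (by decide) hr₁.size (fun _ _ _ h => h)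
      (by simp [hf₁.arr 5 rfl]) ?_
    intro j hj s₂ hw hf₂ hI
    have h1 := (hr₁.frame hf₂).eval_adjExpr (x := 8) (y := 3) (u := b) (v := ⟨j, hj⟩)
      (by rw [hf₂.var 8 rfl, hf₁.var 8 rfl, hb]) hw
    classical
    refine .exec hB rfl (by decide) fun w => ?_
    simp only [Program.when, Program.exec, h1]
    have hlt : (w : ℕ) < j + 1 ↔ (w : ℕ) < j ∨ (w : ℕ) = j := by omega
    by_cases hwj : (w : ℕ) = j
    · obtain rfl : w = ⟨j, hj⟩ := Fin.ext hwj
      have := hI ⟨j, hj⟩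
      by_cases a : G.Adj b ⟨j, hj⟩
      · simp [a, Expr.eval, hw]
      · simpa [a] using this
    · have := hI w
      by_cases a : G.Adj b ⟨j, hj⟩
      · simpa [a, Expr.eval, hw, hwj, hlt] using this
      · simpa [a, hwj, hlt] using this
  · intro s₂ hf₂ h
    refine ⟨by rw [hf₂.var 4 rfl, h4], fun i => by rw [hf₂.arr 2 rfl, h2], fun w => ?_⟩
    simpa using h w

theorem appendBest_spec_of_eq_zero (hB : 100 ≤ B) (h7 : s.var 7 = 0) :
    Does B 4 appendBest s fun s' => s' = s :=
  Does.ite (i := 3) (j := 1) hB (by decide) (fun he => absurd h7 he)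
    fun _ => .exec hB rfl (by decide) rfl

/-- Compute a list of vertices such that every vertex has a neighbor in it, by the greedy
algorithm. -/
def greedy : Program := .forLoop 16 0 (.seq pickBest appendBest)

/-- What holds after `j` rounds of the greedy algorithm. -/
structure GreedyInvariant (G : SimpleGraph (Fin n)) [DecidableRel G.Adj] (J j : ℕ) (s : State) :
    Prop where
  le : s.var 4 ≤ j
  lt : ∀ i < s.var 4, s.arr 2 i < n
  dom : ∀ v : Fin n, s.arr 5 v ≠ 0 → ∃ i < s.var 4, ∃ w : Fin n, s.arr 2 i = w ∧ G.Adj v w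
  unmarked : (unmarked s n).card + j ≤ n ∨ (unmarked s n).card = 0
  decay : ((RAM.unmarked s n).card : ℝ) ≤ n * (1 - G.minDegree / n) ^ s.var 4
  size : s.var 4 ≤ J ∨ (s.var 4 : ℝ) + (RAM.unmarked s n).card ≤ J + n / G.minDegree

/-- While the list has at most `J` entries, geometric decay controls the unmarked set. From then on
the length plus the number of unmarked vertices never increases, since each choice marks at least
one vertex. `J` occurs only in the analysis. -/
theorem greedy_spec [DecidableRel G.Adj] (hB : 100 ≤ B) (hn : n + 10 ≤ B) (hr : Ready G s)
    (h0 : s.var 4 = 0) (h5 : ∀ v, s.arr 5 v = 0) (hδ : 0 < G.minDegree) {J : ℕ}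
    (hJ : (n : ℝ) * (1 - G.minDegree / n) ^ J ≤ n / G.minDegree) :
    Does B 8 greedy s fun s' => IsDominatingList G s' ∧ s'.var 4 ≤ n ∧
      (s'.var 4 : ℝ) ≤ J + n / G.minDegree := by
  refine Does.mono (Q := GreedyInvariant G J n) ?_ ?_
  · refine Does.forLoop hB (GreedyInvariant G J) hn (by decide) hr.size
      (fun i s' v h => ?_) ?_ ?_
    · exact ⟨by simpa using h.le, by simpa using h.lt, by simpa using h.dom, h.unmarked,
        by simpa using h.decay, by simpa using h.size⟩
    · refine ⟨h0.le, by simp [h0], by simp [h5], .inl ?_, ?_, .inl (by omega)⟩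
      · simp [unmarked, h5]
      · simp [unmarked, h5, h0]
    intro j hj s₁ hx hf₁ hI
    have hr₁ := hr.frame hf₁
    refine Does.seq (i := 6) (j := 4) hB (pickBest_spec hB hn hr₁) ?_
    rintro s₂ hf₂ ⟨hmax, hbest⟩
    have h4 : s₂.var 4 = s₁.var 4 := hf₂.var 4 rfl
    have h2 : s₂.arr 2 = s₁.arr 2 := hf₂.arr 2 rfl
    have h5 : s₂.arr 5 = s₁.arr 5 := hf₂.arr 5 rfl
    have hU : unmarked s₂ n = unmarked s₁ n := by simp only [unmarked, h5]
    have hδU := minDegree_mul_card_unmarked_le hmax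
    rcases Nat.eq_zero_or_pos (s₂.var 7) with h7 | h7
    · refine (appendBest_spec_of_eq_zero hB h7).mono ?_
      rintro s₃ - rfl
      -- No vertex has an unmarked neighbor, so by the double count and `0 < G.minDegree` everything
      -- is marked.
      have hz : (unmarked s₁ n).card = 0 := by
        rw [h7] at hδU
        rcases Nat.mul_eq_zero.1 (Nat.le_zero.1 hδU) with h | h
        · omega
        · exact h
      refine ⟨?_, ?_, ?_, .inr ?_, ?_, ?_⟩
      · have := hI.le
        omega
      · rw [h4, h2]
        exact hI.lt
      · rw [h4, h2, h5]
        exact hI.dom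
      · rw [hU, hz]
      · rw [h4, hU]
        exact hI.decay
      · rw [h4, hU]
        exact hI.size
    · obtain ⟨b, h8, h7b⟩ := hbest.resolve_left h7.ne'
      refine (appendBest_spec hB hn (hr₁.frame hf₂) h7.ne' h8).mono ?_
      rintro s₃ hf₃ ⟨h4₃, h2₃, h5₃⟩
      rw [h4] at h4₃
      have hcard : (unmarked s₃ n).card + s₂.var 7 = (unmarked s₁ n).card := by
        rw [h7b, gain, ← Finset.card_union_of_disjoint]
        · congr 1
          ext w
          simp only [unmarked, Finset.mem_union, Finset.mem_filter, Finset.mem_univ, true_and,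
            h5₃ w, h5]
          tauto
        · rw [Finset.disjoint_left]
          intro w
          simp only [unmarked, Finset.mem_filter, Finset.mem_univ, true_and, h5₃ w]
          tauto
      have hn0 : (0 : ℝ) < n := by exact_mod_cast b.pos
      have hδ0 : (0 : ℝ) < G.minDegree := by exact_mod_cast hδ
      have hle1 : 0 ≤ 1 - (G.minDegree : ℝ) / n := by
        rw [sub_nonneg, div_le_one hn0]
        have h1 := G.minDegree_le_degree b
        have h2 := G.degree_lt_card_verts b
        rw [Fintype.card_fin] at h2
        exact_mod_cast (by omega : G.minDegree ≤ n)
      have hcard' : ((unmarked s₃ n).card : ℝ) + s₂.var 7 = (unmarked s₁ n).card := by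
        exact_mod_cast hcard
      have hδU' : (G.minDegree : ℝ) * (unmarked s₁ n).card ≤ n * s₂.var 7 := by
        exact_mod_cast hδU
      have hdecay : ((unmarked s₃ n).card : ℝ) ≤
          (unmarked s₁ n).card * (1 - G.minDegree / n) := by
        have : (G.minDegree : ℝ) / n * (unmarked s₁ n).card ≤ s₂.var 7 := by
          rw [div_mul_eq_mul_div, div_le_iff₀ hn0, mul_comm (s₂.var 7 : ℝ)]
          exact hδU'
        linarith
      refine ⟨?_, fun i hi => ?_, fun v hv => ?_, ?_, ?_, ?_⟩
      · have := hI.le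
        omega
      · rw [h2₃]
        split_ifs with h
        · exact b.2
        · rw [h2]
          exact hI.lt i (by omega)
      · by_cases hv1 : s₁.arr 5 v = 0
        · have : G.Adj b v := by
            by_contra h
            exact hv ((h5₃ v).2 ⟨by rw [h5, hv1], h⟩)
          exact ⟨s₁.var 4, by omega, b, by rw [h2₃, if_pos h4.symm], this.symm⟩
        · obtain ⟨i, hi, w, hw, hvw⟩ := hI.dom v hv1
          exact ⟨i, by omega, w, by rw [h2₃, if_neg (by omega), h2, hw], hvw⟩
      · rcases hI.unmarked with h | h
        · left
          omega
        · right
          omega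
      · rw [h4₃, pow_succ, ← mul_assoc]
        exact hdecay.trans (mul_le_mul_of_nonneg_right hI.decay hle1)
      · have h7' : (1 : ℝ) ≤ s₂.var 7 := by exact_mod_cast h7
        have h4' : (s₃.var 4 : ℝ) = s₁.var 4 + 1 := by exact_mod_cast h4₃
        have hkey : (s₁.var 4 : ℝ) + (unmarked s₁ n).card ≤ J + n / G.minDegree →
            (s₃.var 4 : ℝ) + (unmarked s₃ n).card ≤ J + n / G.minDegree := by
          intro h
          rw [h4']
          linarith
        rcases hI.size with h | h
        · rcases h.lt_or_eq with h | h
          · left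
            omega
          · right
            apply hkey
            -- The switch between the two regimes: at length exactly `J` the decay bound and `hJ`
            -- leave at most `n / G.minDegree` unmarked vertices.
            have := hI.decay.trans_eq (by rw [h])
            rw [h]
            linarith
        · exact .inr (hkey h)
  · rintro s₁ - h
    have hU : (unmarked s₁ n).card = 0 := by
      rcases h.unmarked with h | h <;> omega
    have hv : ∀ v : Fin n, s₁.arr 5 v ≠ 0 := by
      intro v hv
      have : v ∈ unmarked s₁ n := by simpa [unmarked] using hv
      rw [Finset.card_eq_zero.1 hU] at this
      simp at this
    refine ⟨⟨h.lt, fun v => ?_⟩, h.le, ?_⟩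
    · obtain ⟨i, hi, w, hw⟩ := h.dom v (hv v)
      exact ⟨i, hi, .inr ⟨w, hw⟩⟩
    · have hpos : (0 : ℝ) ≤ n / G.minDegree := by positivity
      rcases h.size with h | h
      · have : (s₁.var 4 : ℝ) ≤ J := by exact_mod_cast h
        linarith
      · rw [hU] at h
        simpa using h

end RAM

/-! ### The complete algorithm -/

namespace RAM

variable {n B : ℕ} {G : SimpleGraph (Fin n)} {s s' : State}

/-- Put the number of colorings of the list in the array `2` into register `12`. -/
def power : Program :=
  .forLoop 16 4 (.assign 12 (.add (.var 12) (.add (.var 12) (.var 12))))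

theorem power_spec (hB : 100 ≤ B) (hK : s.var 4 + 10 ≤ B) (h12 : s.var 12 = 1) :
    Does B 2 power s fun s' => s'.var 12 = 3 ^ s.var 4 := by
  refine Does.forLoop hB (fun j s' => s'.var 12 = 3 ^ j) hK (by decide) rfl
    (fun _ _ _ h => by simpa using h) (by simpa using h12) ?_
  intro j hj s₁ _ _ hI
  refine .exec hB rfl (by decide) ?_
  simp only [Program.exec, Expr.eval, State.setVar_var, if_true, hI, pow_succ]
  omega

/-- Decide `3`-colorability by trying all colorings of a short dominating list. -/
def threeColor : Program :=
  .seq rows (.seq (.seq (.assign 11 (.const 3)) (.assign 12 (.const 1)))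
    (.seq greedy (.seq shorten (.seq power (.seq enumerate (.assign 0 (.var 21)))))))

theorem threeColor_spec [DecidableRel G.Adj] {J k : ℕ} (hB : 100 ≤ B) (hn : n * n + n + 10 ≤ B)
    (hk : 3 ^ k + 10 ≤ B) (hδ : 0 < G.minDegree)
    (hball : ∀ u v, ∃ x w, G.Adj u x ∧ G.Adj x w ∧ (w = v ∨ G.Adj v w))
    (hJ : (n : ℝ) * (1 - G.minDegree / n) ^ J ≤ n / G.minDegree)
    (hK : ∀ K : ℕ, (K : ℝ) ≤ J + n / G.minDegree → (∀ u, K ≤ G.degree u * G.maxDegree) → K ≤ k) :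
    Does B 24 threeColor (inputState G) (IsThreeColoringAnswer G) := by
  have hn' : n + 10 ≤ B := by nlinarith
  refine Does.seq (i := 2) (j := 23) hB (rows_spec hB hn' G) ?_
  intro s₁ hf₁ hr₁
  refine Does.seq (i := 1) (j := 22) hB (R := fun s' => s'.var 11 = 3 ∧ s'.var 12 = 1)
    (.exec hB rfl (by decide) (by simp [Program.exec, Expr.eval])) ?_
  rintro s₂ hf₂ ⟨h11, h12⟩
  have hr₂ := hr₁.frame hf₂
  refine Does.seq (i := 8) (j := 21) hB
    (greedy_spec hB hn' hr₂ (by rw [hf₂.var 4 rfl, hf₁.var 4 rfl]; rfl) (fun v => ?_) hδ hJ) ?_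
  · rw [hf₂.arr 5 rfl, hf₁.arr 5 rfl]
    simp [inputState]
  rintro s₃ hf₃ ⟨hd₃, -, hsize⟩
  have hr₃ := hr₂.frame hf₃
  refine Does.seq (i := 6) (j := 20) hB (shorten_spec hB hn hr₃ hd₃ hball) ?_
  rintro s₄ hf₄ ⟨hd₄, hle, hdeg⟩
  have hr₄ := hr₃.frame hf₄
  have hKk : s₄.var 4 ≤ k := by
    refine hK _ (le_trans ?_ hsize) hdeg
    exact_mod_cast hle
  have hpow : 3 ^ s₄.var 4 + 10 ≤ B := by
    have : 3 ^ s₄.var 4 ≤ 3 ^ k := Nat.pow_le_pow_right (by decide) hKk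
    omega
  have hKB : s₄.var 4 + 10 ≤ B := by
    have : s₄.var 4 < 3 ^ s₄.var 4 := Nat.lt_pow_self (by decide)
    omega
  refine Does.seq (i := 2) (j := 19) hB
    (power_spec hB hKB (by rw [hf₄.var 12 rfl, hf₃.var 12 rfl, h12])) ?_
  intro s₅ hf₅ h12₅
  have h4 : s₅.var 4 = s₄.var 4 := hf₅.var 4 rfl
  have hr₅ := hr₄.frame hf₅
  refine Does.seq (i := 17) (j := 1) hB
    (enumerate_spec hB hn' hr₅ (hd₄.frame hf₅) (by omega) (by rwa [h4]) ?_
      (by rw [h12₅, h4]) ?_) ?_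
  · rw [hf₅.var 11 rfl, hf₄.var 11 rfl, hf₃.var 11 rfl, h11]
  · rw [hf₅.var 21 rfl, hf₄.var 21 rfl, hf₃.var 21 rfl, hf₂.var 21 rfl, hf₁.var 21 rfl]
    rfl
  rintro s₆ - h
  refine .exec hB rfl (by decide) ?_
  simpa [IsThreeColoringAnswer, Program.exec, Expr.eval] using h

end RAM

/-! ### Irreducible graphs of diameter three -/

namespace SimpleGraph

variable {V : Type*} {G : SimpleGraph V}

/-- On a shortest walk of length 2 or 3 from `u` to `v`, take the vertex after two steps. For
shorter distances step to a neighbor and back, so that `w = u`. -/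
theorem exists_two_step_of_diam_eq_three [Nonempty V] (h : G.diam = 3) (u v : V) :
    ∃ x w, G.Adj u x ∧ G.Adj x w ∧ (w = v ∨ G.Adj v w) := by
  have htop : G.ediam ≠ ⊤ := G.ediam_ne_top_of_diam_ne_zero (by omega)
  have hconn := G.connected_of_ediam_ne_top htop
  have hd : G.dist u v ≤ 3 := h ▸ G.dist_le_diam htop
  obtain ⟨p, hp⟩ := hconn.exists_walk_length_eq_dist u v
  rw [← hp] at hd
  match p, hd with
  | .nil, _ =>
    have : Nontrivial V := G.nontrivial_of_diam_ne_zero (by omega)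
    obtain ⟨x, hx⟩ := hconn.preconnected.exists_adj_of_nontrivial u
    exact ⟨x, u, hx, hx.symm, .inl rfl⟩
  | .cons h₁ .nil, _ => exact ⟨v, u, h₁, h₁.symm, .inr h₁.symm⟩
  | .cons h₁ (.cons h₂ .nil), _ => exact ⟨_, _, h₁, h₂, .inl rfl⟩
  | .cons h₁ (.cons h₂ (.cons h₃ .nil)), _ => exact ⟨_, _, h₁, h₂, .inr h₃.symm⟩
  | .cons _ (.cons _ (.cons _ (.cons _ _))), hd =>
    simp only [Walk.length_cons] at hd
    omega

/-- If `v` were the only neighbor of `u`, any other neighbor `w` of `v` would make `u` and `w`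
siblings. So the connected graph would be the single edge `uv`, of diameter 1. -/
theorem two_le_minDegree [Fintype V] [DecidableRel G.Adj] [Nonempty V]
    (hs : ¬ SiblingsRuleApplies G) (h : G.diam = 3) : 2 ≤ G.minDegree := by
  refine G.le_minDegree_of_forall_le_degree 2 fun u => ?_
  by_contra hu
  obtain ⟨v, -, huv, -⟩ := exists_two_step_of_diam_eq_three h u u
  have honly : ∀ x, G.Adj u x → x = v := by
    intro x hx
    have hc : (G.neighborFinset u).card ≤ 1 := by
      rw [card_neighborFinset_eq_degree]
      omega
    exact Finset.card_le_one.1 hc x (by simpa using hx) v (by simpa using huv)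
  have hv : ∀ w, G.Adj v w → w = u := by
    intro w hw
    by_contra hne
    refine hs ⟨u, w, fun h => hne h.symm, fun x hx => ?_⟩
    rw [mem_neighborSet] at hx ⊢
    rw [honly x hx]
    exact hw.symm
  have hall : ∀ z, z = u ∨ z = v := by
    intro z
    obtain ⟨x, w, hux, hxw, hw⟩ := exists_two_step_of_diam_eq_three h u z
    obtain rfl := honly x hux
    obtain rfl := hv w hxw
    rcases hw with rfl | hw
    · exact .inl rfl
    · exact .inr (honly z hw.symm)
  have hle : ∀ a b, G.dist a b ≤ 1 := by
    intro a b
    rcases hall a with rfl | rfl <;> rcases hall b with rfl | rfl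
    · simp
    · exact (dist_eq_one_iff_adj.2 huv).le
    · exact (dist_eq_one_iff_adj.2 huv.symm).le
    · simp
  obtain ⟨a, b, hab⟩ := G.exists_dist_eq_diam
  have := hle a b
  omega

theorem card_le_of_two_step [Fintype V] [DecidableRel G.Adj] {u : V}
    (h : ∀ v, ∃ x w, G.Adj u x ∧ G.Adj x w ∧ (w = v ∨ G.Adj v w)) :
    Fintype.card V ≤ G.degree u * (G.maxDegree * (G.maxDegree + 1)) := by
  classical
  have hsub : (Finset.univ : Finset V) ⊆ (G.neighborFinset u).biUnion fun x =>
      (G.neighborFinset x).biUnion fun w => insert w (G.neighborFinset w) := by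
    intro v _
    obtain ⟨x, w, hux, hxw, hw⟩ := h v
    simp only [Finset.mem_biUnion, mem_neighborFinset, Finset.mem_insert]
    exact ⟨x, hux, w, hxw, hw.imp Eq.symm Adj.symm⟩
  calc Fintype.card V = (Finset.univ : Finset V).card := rfl
    _ ≤ _ := Finset.card_le_card hsub
    _ ≤ (G.neighborFinset u).card * (G.maxDegree * (G.maxDegree + 1)) := by
      refine Finset.card_biUnion_le_card_mul _ _ _ fun x _ => ?_
      refine (Finset.card_biUnion_le_card_mul _ _ (G.maxDegree + 1) fun w _ => ?_).trans ?_
      · refine (Finset.card_insert_le _ _).trans ?_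
        rw [card_neighborFinset_eq_degree]
        exact Nat.add_le_add_right (G.degree_le_maxDegree w) 1
      · rw [card_neighborFinset_eq_degree]
        exact Nat.mul_le_mul_right _ (G.degree_le_maxDegree x)
    _ = _ := by rw [card_neighborFinset_eq_degree]

end SimpleGraph

/-! ### The running time -/

namespace RAM

theorem le_two_rpow_self {y : ℝ} (hy : 0 ≤ y) : y ≤ (2 : ℝ) ^ y := by
  have h1 : ⌊y⌋₊ + 1 ≤ 2 ^ ⌊y⌋₊ := Nat.lt_two_pow_self
  calc y ≤ ⌊y⌋₊ + 1 := (Nat.lt_floor_add_one y).le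
    _ ≤ ((2 ^ ⌊y⌋₊ : ℕ) : ℝ) := by exact_mod_cast h1
    _ = (2 : ℝ) ^ (⌊y⌋₊ : ℝ) := by simp
    _ ≤ (2 : ℝ) ^ y := Real.rpow_le_rpow_of_exponent_le (by norm_num) (Nat.floor_le hy)

/-- Write `n = (n / d) * d`; both exponents `n / d` and `logb 2 d` are at least 1, so their sum is
at most twice their product. -/
theorem le_rpow_two_mul_div_mul_logb {n d : ℝ} (hd : 2 ≤ d) (hn : d ≤ n) :
    n ≤ (2 : ℝ) ^ (2 * (n / d * Real.logb 2 d)) := by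
  have hd0 : 0 < d := by linarith
  have hy : 1 ≤ n / d := (one_le_div hd0).2 hn
  have hL : 1 ≤ Real.logb 2 d := by
    rw [Real.le_logb_iff_rpow_le (by norm_num) hd0]
    simpa using hd
  calc n = n / d * d := by field_simp
    _ ≤ (2 : ℝ) ^ (n / d) * (2 : ℝ) ^ Real.logb 2 d := by
      rw [Real.rpow_logb (by norm_num) (by norm_num) hd0]
      exact mul_le_mul_of_nonneg_right (le_two_rpow_self (by linarith)) hd0.le
    _ = (2 : ℝ) ^ (n / d + Real.logb 2 d) := (Real.rpow_add (by norm_num) _ _).symm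
    _ ≤ _ := Real.rpow_le_rpow_of_exponent_le (by norm_num) (by nlinarith)

/-- The number of rounds after which the greedy algorithm has marked most vertices. -/
theorem exists_rounds {n d : ℝ} (hd : 2 ≤ d) (hn : d ≤ n) :
    ∃ J : ℕ, n * (1 - d / n) ^ J ≤ n / d ∧ J + n / d ≤ 3 * (n / d * Real.logb 2 d) := by
  have hd0 : 0 < d := by linarith
  have hn0 : 0 < n := by linarith
  have hy : 1 ≤ n / d := (one_le_div hd0).2 hn
  have hlog : 0 ≤ Real.log d := Real.log_nonneg (by linarith)
  have hL : 1 ≤ Real.logb 2 d := by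
    rw [Real.le_logb_iff_rpow_le (by norm_num) hd0]
    simpa using hd
  have hlogb : Real.log d ≤ Real.logb 2 d := by
    rw [Real.logb, le_div_iff₀ (Real.log_pos (by norm_num))]
    have : Real.log 2 ≤ 1 := by
      have := Real.log_le_sub_one_of_pos (show (0 : ℝ) < 2 by norm_num)
      linarith
    nlinarith
  -- By `1 - x ≤ exp (-x)` this many rounds shrink `n` by the factor `d`. Rounding up costs 1, and
  -- each of `n / d * log d`, `1` and `n / d` is at most `n / d * logb 2 d`.
  refine ⟨⌈n / d * Real.log d⌉₊, ?_, ?_⟩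
  · have h0 : 0 ≤ 1 - d / n := by
      rw [sub_nonneg, div_le_one hn0]
      exact hn
    rw [div_eq_mul_inv n d]
    refine mul_le_mul_of_nonneg_left ?_ hn0.le
    calc (1 - d / n) ^ ⌈n / d * Real.log d⌉₊
        ≤ Real.exp (-(d / n)) ^ ⌈n / d * Real.log d⌉₊ :=
          pow_le_pow_left₀ h0 (Real.one_sub_le_exp_neg _) _
      _ = Real.exp (-(d / n * ⌈n / d * Real.log d⌉₊)) := by
          rw [← Real.exp_nat_mul]
          congr 1
          ring
      _ ≤ Real.exp (-(d / n * (n / d * Real.log d))) := by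
          rw [Real.exp_le_exp, neg_le_neg_iff]
          exact mul_le_mul_of_nonneg_left (Nat.le_ceil _) (by positivity)
      _ = d⁻¹ := by
          rw [show d / n * (n / d * Real.log d) = Real.log d by field_simp, Real.exp_neg,
            Real.exp_log hd0]
  · have := Nat.ceil_lt_add_one (show 0 ≤ n / d * Real.log d by positivity)
    nlinarith

/-- A bound for the base of the running time. -/
theorem base_le_two_rpow {n k : ℕ} {x : ℝ} (hx : 1 ≤ x) (hn : (n : ℝ) ≤ (2 : ℝ) ^ (2 * x))
    (hk : (k : ℝ) ≤ 3 * x) : ((n * n + n + 3 ^ k + 100 : ℕ) : ℝ) ≤ (2 : ℝ) ^ (9 * x) := by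
  have h2 : (1 : ℝ) ≤ 2 := by norm_num
  -- Each of the four summands is at most `2 ^ (7 * x)`, where 7 comes from `100 ≤ 2 ^ 7`; the
  -- factor 4 is at most `2 ^ (2 * x)`.
  have h1 : (n : ℝ) * n ≤ (2 : ℝ) ^ (7 * x) := by
    calc (n : ℝ) * n ≤ (2 : ℝ) ^ (2 * x) * (2 : ℝ) ^ (2 * x) := by gcongr
      _ = (2 : ℝ) ^ (2 * x + 2 * x) := (Real.rpow_add (by norm_num) _ _).symm
      _ ≤ _ := Real.rpow_le_rpow_of_exponent_le h2 (by linarith)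
  have h3 : (n : ℝ) ≤ (2 : ℝ) ^ (7 * x) :=
    hn.trans (Real.rpow_le_rpow_of_exponent_le h2 (by linarith))
  have h4 : (3 : ℝ) ^ k ≤ (2 : ℝ) ^ (7 * x) := by
    calc (3 : ℝ) ^ k ≤ (2 ^ 2) ^ k := by gcongr; norm_num
      _ = (2 : ℝ) ^ ((2 * k : ℕ) : ℝ) := by rw [Real.rpow_natCast, pow_mul]
      _ ≤ _ := Real.rpow_le_rpow_of_exponent_le h2 (by push_cast; linarith)
  have h5 : (100 : ℝ) ≤ (2 : ℝ) ^ (7 * x) := by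
    calc (100 : ℝ) ≤ (2 : ℝ) ^ (7 : ℝ) := by norm_num
      _ ≤ _ := Real.rpow_le_rpow_of_exponent_le h2 (by linarith)
  have h6 : (4 : ℝ) ≤ (2 : ℝ) ^ (2 * x) := by
    calc (4 : ℝ) = (2 : ℝ) ^ (2 : ℝ) := by norm_num
      _ ≤ _ := Real.rpow_le_rpow_of_exponent_le h2 (by linarith)
  have h7 : (2 : ℝ) ^ (9 * x) = (2 : ℝ) ^ (7 * x) * (2 : ℝ) ^ (2 * x) := by
    rw [← Real.rpow_add (by norm_num)]
    ring_nf
  have h8 : (0 : ℝ) ≤ (2 : ℝ) ^ (7 * x) := by positivity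
  push_cast
  rw [h7]
  nlinarith

end RAM

/-! ### The main theorem -/

theorem mainTheorem8 :
    ∃ (p : RAM.Program) (C : ℝ), ∀ (n : ℕ) (G : SimpleGraph (Fin n)) [DecidableRel G.Adj],
      IsIrreducibleGraph G → G.diam = 3 →
      ∃ (t : ℕ) (s : RAM.State),
        RAM.Runs p (RAM.inputState G) t s ∧
        RAM.IsThreeColoringAnswer G s ∧
        (t : ℝ) ≤ (2 : ℝ) ^ (C * min ((G.minDegree : ℝ) * (G.maxDegree : ℝ))
          ((n : ℝ) / (G.minDegree : ℝ) * Real.logb 2 (G.minDegree : ℝ))) := by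
  -- The running time is at most `B ^ 24`, and the base `B` is at most 2 to 9 times the minimum.
  refine ⟨RAM.threeColor, 9 * 24, fun n G _ hG hdiam => ?_⟩
  have : Nontrivial (Fin n) := G.nontrivial_of_diam_ne_zero (by omega)
  have hball := SimpleGraph.exists_two_step_of_diam_eq_three hdiam
  have hδ := SimpleGraph.two_le_minDegree hG.siblings hdiam
  obtain ⟨u, hu⟩ := G.exists_minimal_degree_vertex
  have hΔ : G.minDegree ≤ G.maxDegree := hu ▸ G.degree_le_maxDegree u
  have hδn : G.minDegree ≤ n := by
    have := G.degree_lt_card_verts u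
    rw [Fintype.card_fin] at this
    omega
  have hcard := SimpleGraph.card_le_of_two_step (hball u)
  rw [Fintype.card_fin, ← hu] at hcard
  have hδ' : (2 : ℝ) ≤ G.minDegree := by exact_mod_cast hδ
  have hδn' : (G.minDegree : ℝ) ≤ n := by exact_mod_cast hδn
  have hΔ' : (G.minDegree : ℝ) ≤ G.maxDegree := by exact_mod_cast hΔ
  obtain ⟨J, hJ, hJ'⟩ := RAM.exists_rounds hδ' hδn'
  set a : ℝ := (G.minDegree : ℝ) * (G.maxDegree : ℝ) with ha
  set b : ℝ := (n : ℝ) / (G.minDegree : ℝ) * Real.logb 2 (G.minDegree : ℝ) with hb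
  have ha1 : 1 ≤ a := by nlinarith
  have hb1 : 1 ≤ b := by
    have h1 : 1 ≤ (n : ℝ) / G.minDegree := (one_le_div (by linarith)).2 hδn'
    have h2 : 1 ≤ Real.logb 2 (G.minDegree : ℝ) := by
      rw [Real.le_logb_iff_rpow_le (by norm_num) (by linarith)]
      simpa using hδ'
    nlinarith
  have hx : 1 ≤ min a b := le_min ha1 hb1
  have hna : (n : ℝ) ≤ (2 : ℝ) ^ (2 * a) := by
    have h1 : (n : ℝ) ≤ a * (a + 1) := by
      have : (n : ℝ) ≤ G.minDegree * (G.maxDegree * (G.maxDegree + 1)) := by exact_mod_cast hcard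
      have h2 : (G.maxDegree : ℝ) ≤ a := by nlinarith
      calc (n : ℝ) ≤ a * (G.maxDegree + 1) := by rw [ha]; linarith
        _ ≤ a * (a + 1) := by gcongr
    have h3 := RAM.le_two_rpow_self (show 0 ≤ a by linarith)
    have h4 : a * 2 ≤ (2 : ℝ) ^ a * (2 : ℝ) ^ a := by
      refine mul_le_mul h3 ?_ (by norm_num) (by positivity)
      simpa using Real.rpow_le_rpow_of_exponent_le (show (1 : ℝ) ≤ 2 by norm_num) ha1
    -- Bernoulli's inequality for the real exponent `a ≥ 1`.
    have h5 : a + 1 ≤ (2 : ℝ) ^ a := by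
      have h := one_add_mul_self_le_rpow_one_add (show (-1 : ℝ) ≤ 1 by norm_num) ha1
      norm_num at h
      linarith
    calc (n : ℝ) ≤ a * (a + 1) := h1
      _ ≤ (2 : ℝ) ^ a * (2 : ℝ) ^ a := by gcongr
      _ = (2 : ℝ) ^ (2 * a) := by rw [← Real.rpow_add (by norm_num), two_mul]
  have hnx : (n : ℝ) ≤ (2 : ℝ) ^ (2 * min a b) := by
    rcases min_choice a b with h | h <;> rw [h]
    · exact hna
    · exact RAM.le_rpow_two_mul_div_mul_logb hδ' hδn'
  -- The bound for the list length: walk lists give `a`, the greedy list gives `3 * b`, and both are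
  -- covered by three times the minimum.
  obtain ⟨k, hk⟩ : ∃ k, k = ⌊3 * min a b⌋₊ := ⟨_, rfl⟩
  have hbase := RAM.base_le_two_rpow hx hnx
    (hk ▸ Nat.floor_le (show 0 ≤ 3 * min a b by linarith))
  have hB1 : 100 ≤ n * n + n + 3 ^ k + 100 := Nat.le_add_left _ _
  have hB2 : n * n + n + 10 ≤ n * n + n + 3 ^ k + 100 := by
    have := Nat.zero_le (3 ^ k)
    generalize 3 ^ k = P at this
    omega
  have hB3 : 3 ^ k + 10 ≤ n * n + n + 3 ^ k + 100 := by
    generalize 3 ^ k = P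
    omega
  generalize n * n + n + 3 ^ k + 100 = B at hbase hB1 hB2 hB3
  obtain ⟨t, s, hr, ht, hs⟩ := RAM.threeColor_spec (G := G) hB1 hB2 hB3 (by omega) hball hJ
    (fun K hK hKd => by
      rw [hk]
      refine Nat.le_floor ?_
      have h1 : (K : ℝ) ≤ a := by
        have := hKd u
        rw [← hu] at this
        rw [ha]
        exact_mod_cast this
      have h2 : (K : ℝ) ≤ 3 * b := hK.trans hJ'
      rcases min_choice a b with h | h <;> rw [h] <;> linarith)
  refine ⟨t, s, hr, hs, ?_⟩
  calc (t : ℝ) ≤ (B : ℝ) ^ 24 := by exact_mod_cast ht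
    _ ≤ ((2 : ℝ) ^ (9 * min a b)) ^ 24 := by gcongr
    _ = (2 : ℝ) ^ (9 * 24 * min a b) := by
      rw [← Real.rpow_mul_natCast (by norm_num)]
      congr 1
      push_cast
      ring
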